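/- Let $M$ be a lattice, $\sigma\subseteq M_{\mathbb R}$ a rational convex polyhedral cone, $S=M\cap\sigma$, and $k$ a field of characteristic $p>0$; put $R=k[S]$, so that $X=\operatorname{Spec} k[S]$. Let $e\ge 1$ be an integer and let $\psi:k\to k$ be an additive map with $\psi(c^{p^e}d)=c\,\psi(d)$ and $\psi(1)=1$ (if $k$ is perfect, the only such map is $\psi(c)=c^{1/p^e}$). Let $\phi_c:k[M]\to k[M]$ be the canonical splitting: the additive map with $\phi_c(c\,x^m)=\psi(c)\,x^{m/p^e}$ if $m/p^e\in M$, and $\phi_c(c\,x^m)=0$ otherwise. Let $w\in M$ be such that $\phi(\,\cdot\,)=\phi_c(x^{-w}\cdot\,)$ maps $R$ to $R$, i.e. $\phi:R\to R$ is a toric $p^{-e}$-linear map, and let $\phi^n$ be its $n$-th iterate. Let $\mathfrak a\subseteq R$ be a monomial ideal and let $t\ge 0$ be a rational number whose denominator (in lowest terms) is not divisible by $p$. Let $\operatorname{Newt}(\mathfrak a)\subseteq M_{\mathbb R}$ be the convex hull of $\{v\in S\mid x^v\in\mathfrak a\}$, and let $P=t\cdot\operatorname{Newt}(\mathfrak a)$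 if $t>0$ and $P=\sigma$ if $t=0$ (as $\mathfrak a^0=R$). Let $\mathcal F$ be the set of nonempty faces of $P$, including $P$ itself. For $F\in\mathcal F$ let $I_F\subseteq R$ be the ideal generated by the monomials $x^v$ such that $v\in S$ lies in the relative interior of $\frac{w}{1-p^e}+F'$ for some $F'\in\mathcal F$ with $F'\supseteq F$. (The relative interior of a convex set is its interior in its affine hull; the relative interior of a point is the point.) Write $\overline{J}$ for the integral closure of an ideal $J$. Call an ideal $I\subseteq R$ fixed if $$\sum_{n}\phi^n\left(\overline{\mathfrak a^{t(p^{ne}-1)}}\cdot I\right)=I,$$ where the sum is over all integers $n>0$ such that $t(p^{ne}-1)$ is an integer. Then: 1. an ideal $I\subseteq R$ is fixed if and only if $I=\sum_{F\in\mathcal G}I_F$ for some (possibly empty) subset $\mathcal G\subseteq\mathcal F$; 2. a nonzero ideal $I\subseteq R$ is fixed if and only if $I=\sum_{F\in\mathcal G}I_F$ for some nonempty subset $\mathcal G\subseteq\mathcal F$. -/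

import Mathlib

open scoped Pointwise

noncomputable section

namespace ToricFixed

section IntegralClosure

variable {R : Type*} [CommRing R]

/-- `x` satisfies a monic equation `x ^ n + ∑_{i < n} a i * x ^ i = 0` with `a i ∈ J ^ (n - i)`. -/
def IsIntegralOverIdeal (J : Ideal R) (x : R) : Prop :=
  ∃ (n : ℕ) (a : ℕ → R), (∀ i < n, a i ∈ J ^ (n - i)) ∧
    x ^ n + ∑ i ∈ Finset.range n, a i * x ^ i = 0

theorem isIntegralOverIdeal_iff (J : Ideal R) (x : R) :
    IsIntegralOverIdeal J x ↔
      IsIntegral (reesAlgebra J) (Polynomial.monomial 1 x : Polynomial R) := by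
  classical
  constructor
  · rintro ⟨n, a, ha, h⟩
    let b : ℕ → reesAlgebra J := fun i =>
      if hi : i < n then ⟨Polynomial.monomial (n - i) (a i),
        reesAlgebra.monomial_mem.2 (ha i hi)⟩ else 0
    refine ⟨Polynomial.X ^ n + ∑ i ∈ Finset.range n, Polynomial.C (b i) * Polynomial.X ^ i, ?_, ?_⟩
    · apply Polynomial.monic_X_pow_add
      refine lt_of_le_of_lt (Polynomial.degree_sum_le _ _) ?_
      refine (Finset.sup_lt_iff (WithBot.bot_lt_coe n)).2 fun i hi => ?_
      refine lt_of_le_of_lt (Polynomial.degree_C_mul_X_pow_le _ _) ?_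
      exact WithBot.coe_lt_coe.2 (Finset.mem_range.1 hi)
    · have e : ∀ i ∈ Finset.range n,
          Polynomial.eval₂ (algebraMap (reesAlgebra J) (Polynomial R)) (Polynomial.monomial 1 x)
            (Polynomial.C (b i) * Polynomial.X ^ i) = Polynomial.monomial n (a i * x ^ i) := by
        intro i hi
        have hi' := Finset.mem_range.1 hi
        have hb : algebraMap (reesAlgebra J) (Polynomial R) (b i)
            = Polynomial.monomial (n - i) (a i) := by
          simp only [b, dif_pos hi']; rfl
        rw [Polynomial.eval₂_mul, Polynomial.eval₂_C, Polynomial.eval₂_X_pow, hb,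
          Polynomial.monomial_pow, Polynomial.monomial_mul_monomial, one_mul,
          Nat.sub_add_cancel hi'.le]
      rw [Polynomial.eval₂_add, Polynomial.eval₂_X_pow, Polynomial.eval₂_finsetSum,
        Finset.sum_congr rfl e, Polynomial.monomial_pow, one_mul, ← map_sum, ← map_add, h, map_zero]
  · rintro ⟨P, hP, h⟩
    refine ⟨P.natDegree, fun i => (P.coeff i : Polynomial R).coeff (P.natDegree - i),
      fun i _ => (P.coeff i).2 _, ?_⟩
    have h2 := congrArg (fun f => Polynomial.coeff f P.natDegree) h
    simp only [Polynomial.eval₂_eq_sum_range, Polynomial.finsetSum_coeff, Polynomial.coeff_zero,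
      Polynomial.monomial_pow, one_mul] at h2
    have e : ∀ i ∈ Finset.range (P.natDegree + 1),
        ((algebraMap (reesAlgebra J) (Polynomial R) (P.coeff i)) *
          Polynomial.monomial i (x ^ i)).coeff P.natDegree
        = (P.coeff i : Polynomial R).coeff (P.natDegree - i) * x ^ i := by
      intro i hi
      have hi' : i ≤ P.natDegree := Nat.lt_succ_iff.1 (Finset.mem_range.1 hi)
      conv_lhs => rw [← Nat.sub_add_cancel hi']
      rw [Polynomial.coeff_mul_monomial]
      rfl
    rw [Finset.sum_congr rfl e, Finset.sum_range_succ, hP.coeff_natDegree] at h2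
    simp only [Nat.sub_self, OneMemClass.coe_one, Polynomial.coeff_one_zero, one_mul] at h2
    rw [add_comm]
    exact h2

/-- The integral closure `J̄` of an ideal `J`. -/
def idealIntegralClosure (J : Ideal R) : Ideal R where
  carrier := {x | IsIntegralOverIdeal J x}
  add_mem' {x y} hx hy := by
    simp only [Set.mem_ofPred_eq, isIntegralOverIdeal_iff, map_add] at *
    exact hx.add hy
  zero_mem' := by
    simp only [Set.mem_ofPred_eq, isIntegralOverIdeal_iff, map_zero]
    exact isIntegral_zero
  smul_mem' c x hx := by
    obtain ⟨n, a, ha, h⟩ := hx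
    refine ⟨n, fun i => c ^ (n - i) * a i, fun i hi => Ideal.mul_mem_left _ _ (ha i hi), ?_⟩
    have e : ∀ i ∈ Finset.range n, c ^ (n - i) * a i * (c • x) ^ i = c ^ n * (a i * x ^ i) := by
      intro i hi
      rw [smul_eq_mul, mul_pow,
        ← Nat.sub_add_cancel (Finset.mem_range.1 hi).le, pow_add c, Nat.add_sub_cancel]
      ring
    rw [Finset.sum_congr rfl e, ← Finset.mul_sum, smul_eq_mul, mul_pow, ← mul_add, h, mul_zero]

/-- `∑_{n > 0} φⁿ(closure of 𝔞 ^ (t (p ^ (n e) - 1)) · I) = I`, the sum running over those `n > 0`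
for which the exponent `N = t (p ^ (n e) - 1)` is a (natural) integer. -/
def IsCartierFixed (p e : ℕ) (φ : AddMonoid.End R) (t : ℚ) (𝔞 I : Ideal R) : Prop :=
  (⨆ (n : ℕ) (N : ℕ) (_ : 0 < n) (_ : (N : ℚ) = t * ((p : ℚ) ^ (n * e) - 1)),
    (Submodule.toAddSubgroup (idealIntegralClosure (𝔞 ^ N) * I)).map (φ ^ n)) =
      Submodule.toAddSubgroup I

end IntegralClosure

section CanonicalSplitting

variable {k M : Type*} [Field k] [AddCommGroup M] [IsAddTorsionFree M]

/-- A `p ^ (-e)`-linear splitting of the `e`-th Frobenius of the field `k`; if `k` is perfect, the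
only one is `c ↦ c ^ (1 / p ^ e)`. -/
structure IsFrobeniusSplitting (p e : ℕ) (ψ : k →+ k) : Prop where
  semilinear : ∀ c d : k, ψ (c ^ p ^ e * d) = c * ψ d
  map_one : ψ 1 = 1

/-- The canonical map `φ_c` on `k[M]`: `c x^m ↦ ψ(c) x^(m / q)` if `m / q ∈ M`, and `c x^m ↦ 0`
otherwise. In terms of coefficients: the coefficient of `φ_c f` at `m` is `ψ` of that of `f`
at `q m`. -/
def canonicalSplitting (ψ : k →+ k) (q : ℕ) (hq : q ≠ 0) :
    AddMonoidAlgebra k M →+ AddMonoidAlgebra k M where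
  toFun f := .ofCoeff ((f.coeff.comapDomain (fun m : M => q • m)
    (nsmul_right_injective hq).injOn).mapRange ψ (map_zero ψ))
  map_zero' := by ext; simp
  map_add' f g := by ext; simp

/-- `f ↦ φ_c(x^(-w) f)`. -/
def toricMap (ψ : k →+ k) (q : ℕ) (hq : q ≠ 0) (w : M) (f : AddMonoidAlgebra k M) :
    AddMonoidAlgebra k M :=
  canonicalSplitting ψ q hq (AddMonoidAlgebra.single (-w) 1 * f)

end CanonicalSplitting

section Toric

variable {V : Type*} [NormedAddCommGroup V] [NormedSpace ℝ V] (M : Submodule ℤ V)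

/-- `σ` is generated, as a cone, by finitely many points of the lattice `M`. -/
def IsRationalPolyhedral (σ : PointedCone ℝ V) : Prop :=
  ∃ T : Finset V, (T : Set V) ⊆ M ∧ σ = PointedCone.hull ℝ (T : Set V)

instance instIsAddTorsionFreeLattice : IsAddTorsionFree M :=
  haveI : IsAddTorsionFree V := .of_isTorsionFree ℝ V
  M.subtype_injective.isAddTorsionFree M.subtype.toAddMonoidHom

/-- The semigroup `S = M ∩ σ`. -/
def latticePoints (σ : PointedCone ℝ V) : AddSubmonoid M :=
  σ.toAddSubmonoid.comap M.subtype.toAddMonoidHom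

variable {M} (k : Type*) [Field k] {σ : PointedCone ℝ V}

/-- The inclusion `k[S] → k[M]`. -/
def inclusion : AddMonoidAlgebra k (latticePoints M σ) →ₐ[k] AddMonoidAlgebra k M :=
  AddMonoidAlgebra.mapDomainAlgHom k k (latticePoints M σ).subtype

/-- The monomial `x^v` of `k[S]`. -/
def mono (v : latticePoints M σ) : AddMonoidAlgebra k (latticePoints M σ) :=
  AddMonoidAlgebra.single v 1

variable {k}

def IsMonomialIdeal (𝔞 : Ideal (AddMonoidAlgebra k (latticePoints M σ))) : Prop :=
  ∃ Γ : Set (latticePoints M σ), 𝔞 = Ideal.span (mono k '' Γ)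

/-- The Newton polyhedron: the convex hull of the exponents of the monomials in `𝔞`. -/
def newt (𝔞 : Ideal (AddMonoidAlgebra k (latticePoints M σ))) : Set V :=
  convexHull ℝ {x : V | ∃ a : latticePoints M σ, mono k a ∈ 𝔞 ∧ ((a : M) : V) = x}

open Classical in
/-- The polyhedron `t · Newt(𝔞)`. As `𝔞 ^ 0` is the unit ideal, for `t = 0` it is
the Newton polyhedron `σ` of the unit ideal. -/
def scaledNewt (t : ℚ) (𝔞 : Ideal (AddMonoidAlgebra k (latticePoints M σ))) : Set V :=
  if t = 0 then (σ : Set V) else (t : ℝ) • newt 𝔞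

/-- The nonempty faces of `P`: the subsets on which some linear functional attains its maximum
over `P`; in particular `P` itself, if nonempty. -/
def faces (P : Set V) : Set (Set V) :=
  {F | F.Nonempty ∧ IsExposed ℝ P F}

variable (k σ) in
/-- The ideal `I_F` generated by the `x^v` with `v ∈ S` in the relative interior of `u + F'`
for some face `F' ⊇ F` of `P`. -/
def faceIdeal (P : Set V) (u : V) (F : Set V) : Ideal (AddMonoidAlgebra k (latticePoints M σ)) :=
  Ideal.span {f | ∃ v : latticePoints M σ, mono k v = f ∧
    ∃ F' ∈ faces P, F ⊆ F' ∧ ((v : M) : V) ∈ intrinsicInterior ℝ (u +ᵥ F')}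

end Toric

end ToricFixed

end

/-! Put q = p^e and u = w/(1-q). On exponents, φ^n inverts the homothety of centre u and ratio q^n:
the coefficient of φ^n(f) at v is ψ^n of the coefficient of f at `homothety q w n v`. For admissible
n, the integral closure of 𝔞^(t(q^n-1)) is spanned by the monomials with exponent in (q^n-1)P
(`mem_idealIntegralClosure_pow_iff_scaledNewt`). So the n-th summand takes x^a to x^v exactly when
v-u = q^(-n)(a-u) + (1-q^(-n))y for some y in P.

Sums of the I_F are fixed (`fixed_iSup_faceIdeal`). If a-u lies in P, this relation makes v-u a
convex combination of points of P with positive weight on a-u, so the face having v-u in its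
relative interior contains the one having a-u there (`subset_face_of_combo_mem`): the sum is stable.
Taking a = v and y = v-u recovers every monomial.

Conversely, let I be fixed, with finite generating set H. Substituting the fixed-point equation into
itself writes each element of I as a sum of terms φ^n(c x^b h), with h in H and all n as large as
desired (`mem_tailSubgroup_of_fixed`). This has two consequences. For large n, distinct exponents
occurring in H are incongruent modulo q^n M, so each term has at most one monomial, and I is a
monomial ideal (`mono_mem_of_mem_tailSubgroup`). Letting n grow in the half-space inequalities of P
shows that the exponents of I lie in u+P (`sub_mem_of_mem_tailSubgroup`). Finally, if x^v is in I
and v-u is in F, then I contains I_F: for v' in the relative interior of u+F' with F' ⊇ F, the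
segment from v to v' can be prolonged slightly beyond v' inside u+F', and for large n its endpoint
supplies the y needed to pass from v to v' (`faceIdeal_le_of_mono_mem`). Hence I is the sum of the
I_F that it contains. -/

namespace ToricFixed

/-! ### Polyhedra as intersections of half-spaces, and their faces. -/

section Polyhedra

/-- Weyl's theorem: a finitely generated cone is a finite intersection of half-spaces. -/
theorem exists_finite_dual_mem_hull_iff {E : Type*} [AddCommGroup E] [Module ℝ E]
    [FiniteDimensional ℝ E] {T : Set E} (hT : T.Finite) :
    ∃ L : Set (Module.Dual ℝ E), L.Finite ∧
      ∀ x, x ∈ PointedCone.hull ℝ T ↔ ∀ f ∈ L, 0 ≤ f x := by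
  induction T, hT using Set.Finite.induction_on with
  | empty =>
    let b := Module.finBasis ℝ E
    refine ⟨Set.range b.coord ∪ Set.range (fun i => -b.coord i),
      (Set.finite_range _).union (Set.finite_range _), fun x => ?_⟩
    simp only [PointedCone.hull, Submodule.span_empty, Submodule.mem_bot]
    constructor
    · rintro rfl f -
      simp
    · intro h
      refine b.ext_elem fun i => ?_
      have h1 := h (b.coord i) (Or.inl ⟨i, rfl⟩)
      have h2 := h (-b.coord i) (Or.inr ⟨i, rfl⟩)
      simp only [LinearMap.neg_apply, Module.Basis.coord_apply] at h1 h2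
      simp only [map_zero, Finsupp.coe_zero, Pi.zero_apply]
      linarith
  | @insert t T ht hT ih =>
    obtain ⟨L, hL, h⟩ := ih
    -- Fourier–Motzkin elimination of s from the conditions f (x - s • t) ≥ 0: each f with f t > 0
    -- bounds s above, each g with g t < 0 bounds it below, and the mixed functionals say that these
    -- bounds are compatible.
    refine ⟨{f ∈ L | 0 ≤ f t} ∪ Set.image2 (fun f g => f t • g - g t • f)
      {f ∈ L | 0 < f t} {g ∈ L | g t < 0},
      (hL.subset fun _ h => h.1).union
        (Set.Finite.image2 _ (hL.subset fun _ h => h.1) (hL.subset fun _ h => h.1)), fun x => ?_⟩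
    constructor
    · intro hx
      obtain ⟨a, z, hz, rfl⟩ := Submodule.mem_span_insert.1 hx
      have hz' := (h z).1 hz
      have ea : ∀ f : Module.Dual ℝ E, f (a • t) = (a : ℝ) * f t := fun f => by
        rw [show a • t = (a : ℝ) • t from rfl, map_smul, smul_eq_mul]
      rintro f (⟨hf, hft⟩ | ⟨f, ⟨hf, hft⟩, g, ⟨hg, hgt⟩, rfl⟩)
      · rw [map_add, ea]
        have := hz' f hf
        have := mul_nonneg a.2 hft
        linarith
      · simp only [LinearMap.sub_apply, LinearMap.smul_apply, map_add, ea, smul_eq_mul]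
        have h1 := mul_nonneg hft.le (hz' g hg)
        have h2 := mul_nonneg (neg_pos.2 hgt).le (hz' f hf)
        linarith
    · intro hx
      -- The largest lower bound on s works; inserting 0 ensures s ≥ 0.
      have hA : (insert 0 ((fun f : Module.Dual ℝ E => f x / f t) ''
          {f ∈ L | f t < 0})).Finite := ((hL.subset fun _ h => h.1).image _).insert _
      obtain ⟨s, hs, hmax⟩ := Set.exists_max_image _ id hA (Set.insert_nonempty _ _)
      have hs0 : 0 ≤ s := hmax 0 (Set.mem_insert _ _)
      refine Submodule.mem_span_insert.2 ⟨⟨s, hs0⟩, x - s • t, (h _).2 fun f hf => ?_, ?_⟩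
      · rw [map_sub, map_smul, smul_eq_mul, sub_nonneg]
        rcases lt_trichotomy (f t) 0 with hft | hft | hft
        · have := hmax _ (Set.mem_insert_of_mem _ ⟨f, ⟨hf, hft⟩, rfl⟩)
          simp only [id] at this
          rwa [div_le_iff_of_neg hft] at this
        · rw [hft, mul_zero]
          exact hx f (Or.inl ⟨hf, hft.ge⟩)
        · rcases hs with rfl | ⟨g, ⟨hg, hgt⟩, rfl⟩
          · rw [zero_mul]
            exact hx f (Or.inl ⟨hf, hft.le⟩)
          · have := hx _ (Or.inr ⟨f, ⟨hf, hft⟩, g, ⟨hg, hgt⟩, rfl⟩)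
            simp only [LinearMap.sub_apply, LinearMap.smul_apply, smul_eq_mul] at this
            rw [div_mul_eq_mul_div, div_le_iff_of_neg hgt]
            linarith
      · change x = s • t + (x - s • t)
        abel

variable {V : Type*} [NormedAddCommGroup V] [NormedSpace ℝ V]

/-- A finite intersection of closed affine half-spaces. -/
def IsHalfSpaceIntersection (P : Set V) : Prop :=
  ∃ L : Finset ((V →L[ℝ] ℝ) × ℝ), ∀ x, x ∈ P ↔ ∀ z ∈ L, 0 ≤ z.1 x + z.2

theorem IsHalfSpaceIntersection.smul {P : Set V} (hP : IsHalfSpaceIntersection P) {c : ℝ}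
    (hc : 0 < c) : IsHalfSpaceIntersection (c • P) := by
  classical
  obtain ⟨L, h⟩ := hP
  refine ⟨L.image fun z => (z.1, c * z.2), fun x => ?_⟩
  rw [Set.mem_smul_set_iff_inv_smul_mem₀ hc.ne', h, Finset.forall_mem_image]
  refine forall₂_congr fun z _ => ?_
  rw [map_smul, smul_eq_mul, ← mul_nonneg_iff_of_pos_left hc]
  congr! 1
  field_simp

/-- The convex hull of `Γ + σ`, for `Γ` finite and `σ` a finitely generated cone, is a finite
intersection of half-spaces. -/
theorem isHalfSpaceIntersection_of_recession [FiniteDimensional ℝ V] {Q : Set V} (hQ : Convex ℝ Q)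
    {σ : PointedCone ℝ V} (hσ : σ.FG) (hQσ : ∀ x ∈ Q, ∀ y ∈ σ, x + y ∈ Q)
    {Γ : Set V} (hΓ : Γ.Finite) (hΓQ : Γ ⊆ Q)
    (hQΓ : Q ⊆ convexHull ℝ {x | ∃ y ∈ Γ, ∃ z ∈ σ, x = y + z}) :
    IsHalfSpaceIntersection Q := by
  classical
  obtain ⟨T, rfl⟩ := hσ
  let σ : PointedCone ℝ V := PointedCone.hull ℝ (T : Set V)
  -- Homogenization: Q is the slice at height 1 of the cone generated by G, to which Weyl's theorem
  -- applies.
  let G : Set (V × ℝ) := (fun x => (x, (1 : ℝ))) '' Γ ∪ (fun x => (x, (0 : ℝ))) '' T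
  have hG : G.Finite := (hΓ.image _).union (T.finite_toSet.image _)
  obtain ⟨L, hL, h⟩ := exists_finite_dual_mem_hull_iff hG
  -- The cone over Q × {1}, with σ at height 0. It contains G, so the slice at height 1 of the cone
  -- generated by G is no larger than Q.
  let K : PointedCone ℝ (V × ℝ) :=
    { carrier := {x | ∃ y ∈ σ, (x.2 = 0 ∧ x.1 = y) ∨ (0 < x.2 ∧ ∃ z ∈ Q, x.1 = x.2 • z + y)}
      zero_mem' := ⟨0, zero_mem _, Or.inl ⟨rfl, rfl⟩⟩
      add_mem' := by
        rintro ⟨a, s⟩ ⟨b, r⟩ ⟨y, hy, h1⟩ ⟨z, hz, h2⟩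
        refine ⟨y + z, add_mem hy hz, ?_⟩
        simp only [Prod.mk_add_mk] at h1 h2 ⊢
        rcases h1 with ⟨rfl, rfl⟩ | ⟨hs, c, hc, rfl⟩ <;> rcases h2 with ⟨rfl, rfl⟩ | ⟨hr, d, hd, rfl⟩
        · exact Or.inl ⟨add_zero _, rfl⟩
        · refine Or.inr ⟨by simpa using hr, d, hd, ?_⟩
          rw [zero_add]; abel
        · refine Or.inr ⟨by simpa using hs, c, hc, ?_⟩
          rw [add_zero]; abel
        · refine Or.inr ⟨by positivity, (s / (s + r)) • c + (r / (s + r)) • d,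
            hQ hc hd (by positivity) (by positivity) (by field_simp), ?_⟩
          have : s + r ≠ 0 := by positivity
          rw [smul_add, smul_smul, smul_smul, mul_div_cancel₀ _ this, mul_div_cancel₀ _ this]
          abel
      smul_mem' := by
        rintro ⟨c, hc⟩ ⟨a, s⟩ ⟨y, hy, h1⟩
        refine ⟨c • y, PointedCone.smul_mem _ hc hy, ?_⟩
        change (c * s = 0 ∧ c • a = c • y) ∨ (0 < c * s ∧ ∃ z ∈ Q, c • a = (c * s) • z + c • y)
        simp only at h1
        rcases h1 with ⟨rfl, rfl⟩ | ⟨hs, z, hz, rfl⟩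
        · exact Or.inl ⟨mul_zero _, rfl⟩
        · rcases hc.eq_or_lt with rfl | hc
          · simp
          · exact Or.inr ⟨by positivity, z, hz, by rw [smul_add, smul_smul]⟩ }
  have hGK : PointedCone.hull ℝ G ≤ K := by
    refine Submodule.span_le.2 ?_
    rintro _ (⟨x, hx, rfl⟩ | ⟨x, hx, rfl⟩)
    · exact ⟨0, zero_mem _, Or.inr ⟨one_pos, x, hΓQ hx, by simp⟩⟩
    · exact ⟨x, PointedCone.subset_hull hx, Or.inl ⟨rfl, rfl⟩⟩
  have hσG : ∀ z ∈ σ, (z, (0 : ℝ)) ∈ PointedCone.hull ℝ G := by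
    intro z hz
    refine Submodule.span_induction (p := fun z _ => (z, (0 : ℝ)) ∈ PointedCone.hull ℝ G)
      (fun x hx => PointedCone.subset_hull (Or.inr ⟨x, hx, rfl⟩)) (zero_mem _)
      (fun x y _ _ hx hy => ?_) (fun c x _ hx => ?_) hz
    · have := add_mem hx hy
      rwa [Prod.mk_add_mk, add_zero] at this
    · have := Submodule.smul_mem _ c hx
      rwa [Prod.smul_mk, smul_zero] at this
  have key : ∀ x, x ∈ Q ↔ (x, (1 : ℝ)) ∈ PointedCone.hull ℝ G := by
    intro x
    constructor
    · intro hx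
      have hc : Convex ℝ {x : V | (x, (1 : ℝ)) ∈ PointedCone.hull ℝ G} := by
        intro a ha b hb s r hs hr hsr
        have := (PointedCone.convex (PointedCone.hull ℝ G)) ha hb hs hr hsr
        simp only [Prod.smul_mk, Prod.mk_add_mk, smul_eq_mul, mul_one, hsr] at this
        exact this
      refine convexHull_min ?_ hc (hQΓ hx)
      rintro _ ⟨y, hy, z, hz, rfl⟩
      have := add_mem (PointedCone.subset_hull (R := ℝ) (s := G) (Or.inl ⟨y, hy, rfl⟩)) (hσG z hz)
      rwa [Prod.mk_add_mk, add_zero] at this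
    · intro hx
      obtain ⟨y, hy, ⟨h0, -⟩ | ⟨-, z, hz, e⟩⟩ := hGK hx
      · exact absurd h0 one_ne_zero
      · simp only [one_smul] at e
        rw [e]
        exact hQσ z hz y hy
  refine ⟨hL.toFinset.image fun f => (LinearMap.toContinuousLinearMap (f ∘ₗ LinearMap.inl ℝ V ℝ),
    f (0, 1)), fun x => ?_⟩
  rw [key, h, Finset.forall_mem_image]
  simp only [Set.Finite.mem_toFinset, LinearMap.coe_toContinuousLinearMap', LinearMap.comp_apply,
    LinearMap.inl_apply, ← map_add, Prod.mk_add_mk, add_zero, zero_add]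

theorem isHalfSpaceIntersection_cone [FiniteDimensional ℝ V] {σ : PointedCone ℝ V} (hσ : σ.FG) :
    IsHalfSpaceIntersection (σ : Set V) :=
  isHalfSpaceIntersection_of_recession σ.convex hσ (fun _ hx _ hy => add_mem hx hy)
    (Set.finite_singleton 0) (Set.singleton_subset_iff.2 (zero_mem _))
    fun x hx => subset_convexHull _ _ ⟨0, rfl, x, hx, (zero_add x).symm⟩

theorem eventually_lineMap_mem_of_mem_intrinsicInterior {s : Set V} {x v : V}
    (hv : v ∈ intrinsicInterior ℝ s) (hx : x ∈ s) :
    ∀ᶠ c in nhds (1 : ℝ), AffineMap.lineMap x v c ∈ s := by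
  obtain ⟨y, hy, rfl⟩ := mem_intrinsicInterior.1 hv
  have hx' := subset_affineSpan ℝ s hx
  let g : ℝ → affineSpan ℝ s := fun c => ⟨AffineMap.lineMap x (y : V) c,
    AffineMap.lineMap_mem c hx' y.2⟩
  have hg : Continuous g := AffineMap.lineMap_continuous.subtype_mk _
  have h1 : g 1 = y := Subtype.ext (AffineMap.lineMap_apply_one _ _)
  exact hg.continuousAt.eventually (by rw [h1]; exact mem_interior_iff_mem_nhds.1 hy)

/-- The face is cut out by the constraints active at v - u. Minus the sum of these is a functional
whose maximum over P is attained exactly there. The inactive constraints stay strict near v, so they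
do not restrict a neighbourhood in the affine span. -/
theorem exists_face_mem_intrinsicInterior {P : Set V} (hP : IsHalfSpaceIntersection P) {u v : V}
    (hv : v - u ∈ P) : ∃ F ∈ faces P, v ∈ intrinsicInterior ℝ (u +ᵥ F) := by
  classical
  obtain ⟨L, h⟩ := hP
  let A := L.filter fun z => z.1 (v - u) + z.2 = 0
  let F : Set V := {y ∈ P | ∀ z ∈ A, z.1 y + z.2 = 0}
  have hvF : v - u ∈ F := ⟨hv, fun z hz => (Finset.mem_filter.1 hz).2⟩
  have hvF' : v ∈ u +ᵥ F := ⟨v - u, hvF, by simp⟩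
  refine ⟨F, ⟨⟨_, hvF⟩, fun _ => ⟨-∑ z ∈ A, z.1, ?_⟩⟩, ?_⟩
  · ext y
    simp only [F, Set.mem_ofPred_eq, neg_apply, sum_apply,
      neg_le_neg_iff]
    refine and_congr_right fun hy => ⟨fun hyA y' hy' => ?_, fun hy' z hz => ?_⟩
    · refine Finset.sum_le_sum fun z hz => ?_
      have := (h y').1 hy' z (Finset.mem_filter.1 hz).1
      linarith [hyA z hz]
    · have h1 := hy' _ hv
      have h2 : ∑ z ∈ A, (z.1 y + z.2) ≤ ∑ z ∈ A, (z.1 (v - u) + z.2) := by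
        rw [Finset.sum_add_distrib, Finset.sum_add_distrib]; linarith
      rw [Finset.sum_eq_zero fun z hz => (Finset.mem_filter.1 hz).2] at h2
      have h3 : ∀ z ∈ A, 0 ≤ z.1 y + z.2 := fun z hz => (h y).1 hy z (Finset.mem_filter.1 hz).1
      exact (Finset.sum_eq_zero_iff_of_nonneg h3).1 (le_antisymm h2 (Finset.sum_nonneg h3)) z hz
  · rw [mem_intrinsicInterior]
    refine ⟨⟨v, subset_affineSpan ℝ _ hvF'⟩, mem_interior_iff_mem_nhds.2 ?_, rfl⟩
    have hact : ∀ y ∈ affineSpan ℝ (u +ᵥ F), ∀ z ∈ A, z.1 (y - u) + z.2 = 0 := by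
      intro y hy z hz
      have : affineSpan ℝ (u +ᵥ F) ≤ (AffineSubspace.mk' v (LinearMap.ker (z.1 : V →ₗ[ℝ] ℝ))) := by
        refine affineSpan_le.2 ?_
        rintro _ ⟨y, hy, rfl⟩
        have h1 := hy.2 z hz
        have h2 := hvF.2 z hz
        simp only [SetLike.mem_coe, AffineSubspace.mem_mk', vsub_eq_sub, vadd_eq_add,
          LinearMap.mem_ker, ContinuousLinearMap.coe_coe, map_sub, map_add] at h1 h2 ⊢
        linarith
      have h1 := this hy
      have h2 := hvF.2 z hz
      simp only [AffineSubspace.mem_mk', vsub_eq_sub,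
          LinearMap.mem_ker, ContinuousLinearMap.coe_coe, map_sub] at h1 h2 ⊢
      linarith
    have hin : ∀ z ∈ L, z ∉ A → ∀ᶠ y : affineSpan ℝ (u +ᵥ F) in
        nhds ⟨v, subset_affineSpan ℝ _ hvF'⟩, 0 < z.1 (y - u) + z.2 := by
      intro z hz hzA
      have hpos : 0 < z.1 (v - u) + z.2 :=
        lt_of_le_of_ne ((h _).1 hv z hz) fun h0 => hzA (Finset.mem_filter.2 ⟨hz, h0.symm⟩)
      have hc : Continuous fun y : affineSpan ℝ (u +ᵥ F) => z.1 ((y : V) - u) + z.2 := by fun_prop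
      exact hc.continuousAt.eventually (lt_mem_nhds hpos)
    have hall := (Filter.eventually_all_finset (L \ A)).2 fun z hz =>
      hin z (Finset.mem_sdiff.1 hz).1 (Finset.mem_sdiff.1 hz).2
    filter_upwards [hall] with y hy
    refine ⟨y - u, ⟨(h _).2 fun z hz => ?_, hact _ y.2⟩, by simp⟩
    by_cases hzA : z ∈ A
    · exact (hact _ y.2 z hzA).ge
    · exact (hy z (Finset.mem_sdiff.2 ⟨hz, hzA⟩)).le

/-- A face that contains a proper convex combination of a point of `P` and a relative interior
point of a second face contains that second face. -/
theorem subset_face_of_combo_mem {P F F' : Set V} {u v v' y : V} (hF : IsExposed ℝ P F)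
    (hF' : F' ⊆ P) (hv : v ∈ intrinsicInterior ℝ (u +ᵥ F))
    (hv' : v' ∈ intrinsicInterior ℝ (u +ᵥ F')) (hy : y ∈ P) {r s : ℝ} (hr : 0 < r) (hs : 0 ≤ s)
    (hrs : r + s = 1) (e : v - u = r • (v' - u) + s • y) : F' ⊆ F := by
  have sub : ∀ {G : Set V} {x : V}, x ∈ intrinsicInterior ℝ (u +ᵥ G) → x - u ∈ G := by
    intro G x hx
    obtain ⟨g, hg, rfl⟩ := intrinsicInterior_subset hx
    simpa using hg
  obtain ⟨l, rfl⟩ := hF ⟨_, sub hv⟩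
  have h1 := (sub hv).2
  have hv'P := hF' (sub hv')
  -- The functional l exposing F is maximal at a combination giving v' - u positive weight, hence
  -- maximal at v' - u itself.
  have hmax : ∀ z ∈ P, l z ≤ l (v' - u) := by
    intro z hz
    have h2 := h1 z hz
    have h3 := h1 y hy
    have h4 := h1 _ hv'P
    rw [e, map_add, map_smul, map_smul, smul_eq_mul, smul_eq_mul] at h2 h3 h4
    have h5 : s = 1 - r := by linarith
    subst h5
    nlinarith
  intro z hz
  refine ⟨hF' hz, fun y hy => (hmax y hy).trans ?_⟩
  -- Go from z through v' - u to a point of F' slightly beyond it; since l cannot increase past v' -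
  -- u, it is not smaller at z.
  have hev := eventually_lineMap_mem_of_mem_intrinsicInterior hv' (x := u + z) ⟨z, hz, rfl⟩
  obtain ⟨c, hc, hc1⟩ := ((hev.filter_mono nhdsWithin_le_nhds).and
    (self_mem_nhdsWithin (s := Set.Ioi (1 : ℝ)))).exists
  obtain ⟨g, hg, hge⟩ := hc
  have hg2 := hmax g (hF' hg)
  have hge' : g = (v' - u) + (c - 1) • ((v' - u) - z) := by
    have : u + g = c • (v' - (u + z)) + (u + z) := hge
    rw [eq_sub_of_add_eq' this, sub_smul, one_smul, sub_sub v' u z]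
    abel
  rw [hge', map_add, map_smul, map_sub, smul_eq_mul] at hg2
  have hc2 : 0 < c - 1 := sub_pos.2 hc1
  have : 0 ≤ (c - 1) * (l z - l (v' - u)) := by simp only [map_sub] at hg2 ⊢; linarith
  linarith [nonneg_of_mul_nonneg_right this hc2]

end Polyhedra

/-! ### Finiteness properties of lattice points. -/

section LatticePoints

variable {V : Type*} [NormedAddCommGroup V] [NormedSpace ℝ V] {M : Submodule ℤ V}

theorem finite_norm_le [FiniteDimensional ℝ V] [DiscreteTopology M] (C : ℝ) :
    {m : M | ‖(m : V)‖ ≤ C}.Finite := by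
  have h : (Metric.closedBall (0 : V) C ∩ (M.toAddSubgroup : Set V)).Finite := by
    have : DiscreteTopology M.toAddSubgroup := inferInstanceAs (DiscreteTopology M)
    exact Metric.finite_isBounded_inter_isClosed DiscreteTopology.isDiscrete
      Metric.isBounded_closedBall AddSubgroup.isClosed_of_discrete
  refine (h.preimage (f := ((↑) : M → V)) Subtype.coe_injective.injOn).subset fun m hm => ?_
  exact ⟨by simpa using hm, m.2⟩

/-- Gordan's lemma. -/
theorem fg_latticePoints [FiniteDimensional ℝ V] [DiscreteTopology M] {σ : PointedCone ℝ V}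
    (hσ : IsRationalPolyhedral M σ) : AddMonoid.FG (latticePoints M σ) := by
  obtain ⟨T, hTM, rfl⟩ := hσ
  let C := ∑ t ∈ T, ‖t‖
  let G : Set (latticePoints M (PointedCone.hull ℝ (T : Set V))) := {s | ‖((s : M) : V)‖ ≤ C}
  have hG : G.Finite :=
    (finite_norm_le (M := M) C).preimage (f := Subtype.val) Subtype.coe_injective.injOn
  refine ⟨⟨hG.toFinset, eq_top_iff.2 fun s _ => ?_⟩⟩
  rw [Set.Finite.coe_toFinset]
  obtain ⟨c, hcT, hc0, hc⟩ := PointedCone.mem_hull_set.1 (show ((s : M) : V) ∈ _ from s.2)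
  replace hcT : c.support ⊆ T := by exact_mod_cast hcT
  rw [Finsupp.sum] at hc
  have hTS : ∀ t ∈ c.support, ∃ g ∈ G, ((g : M) : V) = t := fun t ht =>
    ⟨⟨⟨t, hTM (hcT ht)⟩, PointedCone.subset_hull (hcT ht)⟩,
      Finset.single_le_sum (f := fun t : V => ‖t‖) (fun _ _ => norm_nonneg _) (hcT ht), rfl⟩
  choose! g hgG hg using hTS
  -- The remainder after taking integer parts of the coefficients is a point of S with norm at most
  -- C.
  have hr : ((s : M) : V) - ∑ t ∈ c.support, ⌊c t⌋₊ • t = ∑ t ∈ c.support, (c t - ⌊c t⌋₊) • t := by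
    rw [← hc, ← Finset.sum_sub_distrib]
    exact Finset.sum_congr rfl fun t _ => by rw [sub_smul, Nat.cast_smul_eq_nsmul]
  have hd0 : ∀ t, 0 ≤ c t - ⌊c t⌋₊ := fun t => sub_nonneg.2 (Nat.floor_le (hc0 t))
  let r : latticePoints M (PointedCone.hull ℝ (T : Set V)) :=
    ⟨⟨((s : M) : V) - ∑ t ∈ c.support, ⌊c t⌋₊ • t,
      sub_mem (s : M).2 (sum_mem fun t ht => nsmul_mem (hTM (hcT ht)) _)⟩, by
      change ((s : M) : V) - ∑ t ∈ c.support, ⌊c t⌋₊ • t ∈ PointedCone.hull ℝ (T : Set V)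
      rw [hr]
      exact sum_mem fun t ht =>
        PointedCone.smul_mem _ (hd0 t) (PointedCone.subset_hull (hcT ht))⟩
  have hrG : r ∈ G := by
    change ‖((s : M) : V) - ∑ t ∈ c.support, ⌊c t⌋₊ • t‖ ≤ C
    rw [hr]
    refine (norm_sum_le _ _).trans ((Finset.sum_le_sum fun t _ => ?_).trans
      (Finset.sum_le_sum_of_subset_of_nonneg hcT fun _ _ _ => norm_nonneg _))
    rw [norm_smul, Real.norm_of_nonneg (hd0 t)]
    have := Nat.lt_floor_add_one (c t)
    exact mul_le_of_le_one_left (norm_nonneg _) (by linarith)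
  have e : s = r + ∑ t ∈ c.support, ⌊c t⌋₊ • g t := by
    apply Subtype.ext
    apply Subtype.ext
    have : ((∑ t ∈ c.support, ⌊c t⌋₊ • g t :
        latticePoints M (PointedCone.hull ℝ (T : Set V))) : V) = ∑ t ∈ c.support, ⌊c t⌋₊ • t := by
      push_cast
      exact Finset.sum_congr rfl fun t ht => by rw [hg t ht]
    change ((s : M) : V) = (r : V) + _
    rw [this]
    exact (sub_add_cancel _ _).symm
  rw [e]
  exact add_mem (AddSubmonoid.subset_closure hrG) (sum_mem fun t ht =>
    nsmul_mem (AddSubmonoid.subset_closure (hgG t ht)) _)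

/-- A multiple of a lattice point that is a nonnegative real combination of lattice points
is a combination with natural coefficients, of the same total weight. -/
theorem exists_nsmul_eq_sum_nsmul [FiniteDimensional ℝ V] [DiscreteTopology M] {ι : Type*}
    (s : Finset ι) (a : ι → V) (ha : ∀ i ∈ s, a i ∈ M) (μ : ι → ℝ) (hμ : ∀ i ∈ s, 0 ≤ μ i)
    (N : ℕ) (hN : ∑ i ∈ s, μ i = N) (hb : ∑ i ∈ s, μ i • a i ∈ M) :
    ∃ (n : ℕ) (c : ι → ℕ), 0 < n ∧ ∑ i ∈ s, c i = n * N ∧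
      n • ∑ i ∈ s, μ i • a i = ∑ i ∈ s, c i • a i := by
  -- The lattice and weight errors of rounding down m times the combination. They take finitely many
  -- values, so two multipliers m < m' share them, and subtracting gives an exact integral relation.
  let f : ℕ → M × ℤ := fun m =>
    (⟨m • ∑ i ∈ s, μ i • a i - ∑ i ∈ s, ⌊m * μ i⌋₊ • a i,
      sub_mem (nsmul_mem hb _) (sum_mem fun i hi => nsmul_mem (ha i hi) _)⟩,
      (m * N : ℤ) - ∑ i ∈ s, (⌊m * μ i⌋₊ : ℤ))
  have hd : ∀ (m : ℕ), ∀ i ∈ s, 0 ≤ m * μ i - ⌊m * μ i⌋₊ ∧ m * μ i - ⌊m * μ i⌋₊ ≤ 1 := by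
    intro m i hi
    have h0 : 0 ≤ m * μ i := mul_nonneg m.cast_nonneg (hμ i hi)
    exact ⟨sub_nonneg.2 (Nat.floor_le h0), by linarith [Nat.lt_floor_add_one (m * μ i)]⟩
  have hf : ∀ m, f m ∈ {m : M | ‖(m : V)‖ ≤ ∑ i ∈ s, ‖a i‖} ×ˢ Set.Icc (0 : ℤ) s.card := by
    intro m
    constructor
    · have : ((f m).1 : V) = ∑ i ∈ s, (m * μ i - ⌊m * μ i⌋₊) • a i := by
        simp only [f]
        rw [Finset.smul_sum, ← Finset.sum_sub_distrib]
        refine Finset.sum_congr rfl fun i _ => ?_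
        rw [sub_smul, Nat.cast_smul_eq_nsmul, mul_smul, Nat.cast_smul_eq_nsmul]
      change ‖((f m).1 : V)‖ ≤ _
      rw [this]
      refine (norm_sum_le _ _).trans (Finset.sum_le_sum fun i hi => ?_)
      rw [norm_smul, Real.norm_of_nonneg (hd m i hi).1]
      exact mul_le_of_le_one_left (norm_nonneg _) (hd m i hi).2
    · have : ((f m).2 : ℝ) = ∑ i ∈ s, (m * μ i - ⌊m * μ i⌋₊) := by
        simp only [f]
        push_cast
        rw [← hN, Finset.mul_sum, Finset.sum_sub_distrib]
      constructor
      · have h0 : (0 : ℝ) ≤ ((f m).2 : ℝ) := by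
          rw [this]
          exact Finset.sum_nonneg fun i hi => (hd m i hi).1
        exact_mod_cast h0
      · have h1 : ((f m).2 : ℝ) ≤ s.card := by
          rw [this]
          refine (Finset.sum_le_sum fun i hi => (hd m i hi).2).trans ?_
          simp
        exact_mod_cast h1
  obtain ⟨m, m', hlt, he⟩ := ((finite_norm_le (M := M) (∑ i ∈ s, ‖a i‖)).prod
    (Set.finite_Icc (0 : ℤ) s.card)).exists_lt_map_eq_of_forall_mem hf
  have hmono : ∀ i ∈ s, ⌊m * μ i⌋₊ ≤ ⌊m' * μ i⌋₊ := fun i hi =>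
    Nat.floor_mono (mul_le_mul_of_nonneg_right (by exact_mod_cast hlt.le) (hμ i hi))
  have e1 : m • ∑ i ∈ s, μ i • a i - ∑ i ∈ s, ⌊m * μ i⌋₊ • a i =
      m' • ∑ i ∈ s, μ i • a i - ∑ i ∈ s, ⌊m' * μ i⌋₊ • a i :=
    congrArg (fun x : M × ℤ => (x.1 : V)) he
  have e2 : (m * N : ℤ) - ∑ i ∈ s, (⌊m * μ i⌋₊ : ℤ) = (m' * N : ℤ) - ∑ i ∈ s, (⌊m' * μ i⌋₊ : ℤ) :=
    congrArg Prod.snd he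
  obtain ⟨d, rfl⟩ := Nat.exists_eq_add_of_lt hlt
  refine ⟨d + 1, fun i => ⌊((m + d + 1 : ℕ) : ℝ) * μ i⌋₊ - ⌊m * μ i⌋₊, d.succ_pos, ?_, ?_⟩
  · rw [← Nat.cast_inj (R := ℤ), Nat.cast_sum,
      Finset.sum_congr rfl fun i hi => Nat.cast_sub (hmono i hi), Finset.sum_sub_distrib]
    have h1 : ((m + d + 1 : ℕ) : ℤ) * N = m * N + ((d + 1) * N : ℕ) := by push_cast; ring
    linarith
  · have e3 : ∑ i ∈ s, (⌊((m + d + 1 : ℕ) : ℝ) * μ i⌋₊ - ⌊m * μ i⌋₊) • a i =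
        ∑ i ∈ s, ⌊((m + d + 1 : ℕ) : ℝ) * μ i⌋₊ • a i - ∑ i ∈ s, ⌊m * μ i⌋₊ • a i := by
      rw [← Finset.sum_sub_distrib]
      exact Finset.sum_congr rfl fun i hi => by rw [sub_nsmul _ (hmono i hi), sub_eq_add_neg]
    rw [e3, ← sub_eq_zero]
    rw [add_assoc, add_nsmul, ← sub_eq_zero] at e1
    rw [← neg_eq_zero, ← e1]
    abel_nf

end LatticePoints

/-! ### Monomials and monomial ideals of k[S]. -/

section Monomials

variable {V : Type*} [NormedAddCommGroup V] [NormedSpace ℝ V] {M : Submodule ℤ V}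
  {k : Type*} [Field k] {σ : PointedCone ℝ V}

theorem mono_mul_mono (a b : latticePoints M σ) : mono k a * mono k b = mono k (a + b) := by
  simp [mono, AddMonoidAlgebra.single_mul_single]

theorem mono_pow (a : latticePoints M σ) (n : ℕ) : mono k a ^ n = mono k (n • a) := by
  simp [mono, AddMonoidAlgebra.single_pow]

theorem mono_add_mem {I : Ideal (AddMonoidAlgebra k (latticePoints M σ))} {a : latticePoints M σ}
    (h : mono k a ∈ I) (b : latticePoints M σ) : mono k (a + b) ∈ I := by
  rw [← mono_mul_mono]
  exact I.mul_mem_right _ h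

theorem single_mem {I : Ideal (AddMonoidAlgebra k (latticePoints M σ))} {a : latticePoints M σ}
    (h : mono k a ∈ I) (c : k) : AddMonoidAlgebra.single a c ∈ I := by
  have : AddMonoidAlgebra.single a c = AddMonoidAlgebra.single 0 c * mono k a := by
    simp [mono, AddMonoidAlgebra.single_mul_single]
  rw [this]
  exact I.mul_mem_left _ h

theorem mem_of_forall_mono_mem {I : Ideal (AddMonoidAlgebra k (latticePoints M σ))}
    {f : AddMonoidAlgebra k (latticePoints M σ)} (h : ∀ v ∈ f.coeff.support, mono k v ∈ I) :
    f ∈ I := by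
  rw [← AddMonoidAlgebra.sum_coeff_single f]
  exact I.sum_mem fun v hv => single_mem (h v hv) _

theorem mem_span_mono_iff {Γ : Set (latticePoints M σ)}
    {f : AddMonoidAlgebra k (latticePoints M σ)} :
    f ∈ Ideal.span (mono k '' Γ) ↔ ∀ v ∈ f.coeff.support, ∃ a ∈ Γ, ∃ s, v = a + s := by
  refine AddMonoidAlgebra.mem_ideal_span_of'_image.trans ?_
  simp only [add_comm]

theorem mono_mem_span_mono_iff {Γ : Set (latticePoints M σ)} {v : latticePoints M σ} :
    mono k v ∈ Ideal.span (mono k '' Γ) ↔ ∃ a ∈ Γ, ∃ s, v = a + s := by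
  rw [mem_span_mono_iff]
  simp [mono]

theorem IsMonomialIdeal.mono_mem {I : Ideal (AddMonoidAlgebra k (latticePoints M σ))}
    (hI : IsMonomialIdeal I) {f : AddMonoidAlgebra k (latticePoints M σ)} (hf : f ∈ I)
    {v : latticePoints M σ} (hv : v ∈ f.coeff.support) : mono k v ∈ I := by
  obtain ⟨Γ, rfl⟩ := hI
  exact mono_mem_span_mono_iff.2 (mem_span_mono_iff.1 hf v hv)

theorem exists_add_of_mem_support_mul {f g : AddMonoidAlgebra k (latticePoints M σ)}
    {v : latticePoints M σ} (hv : v ∈ (f * g).coeff.support) :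
    ∃ a ∈ f.coeff.support, ∃ b ∈ g.coeff.support, a + b = v := by
  classical
  exact Finset.mem_add.1 (AddMonoidAlgebra.support_coeff_mul_subset f g hv)

theorem isNoetherianRing_latticePoints [FiniteDimensional ℝ V] [DiscreteTopology M]
    (hσ : IsRationalPolyhedral M σ) :
    IsNoetherianRing (AddMonoidAlgebra k (latticePoints M σ)) := by
  have := fg_latticePoints hσ
  exact Algebra.FiniteType.isNoetherianRing k _

theorem IsMonomialIdeal.exists_finite [FiniteDimensional ℝ V] [DiscreteTopology M]
    (hσ : IsRationalPolyhedral M σ) {I : Ideal (AddMonoidAlgebra k (latticePoints M σ))}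
    (hI : IsMonomialIdeal I) :
    ∃ Γ : Set (latticePoints M σ), Γ.Finite ∧ I = Ideal.span (mono k '' Γ) := by
  have := isNoetherianRing_latticePoints (k := k) hσ
  obtain ⟨Γ, rfl⟩ := hI
  have hfg : (Submodule.span (AddMonoidAlgebra k (latticePoints M σ)) (mono k '' Γ)).FG :=
    IsNoetherian.noetherian _
  obtain ⟨G, hG, e⟩ := (Submodule.fg_span_iff_fg_span_finset_subset _).1 hfg
  obtain ⟨Γ', -, hfin, he⟩ := (Set.exists_subset_image_finite_and (s := Γ) (f := mono k)
    (p := fun s => s = (G : Set _))).1 ⟨G, hG, G.finite_toSet, rfl⟩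
  exact ⟨Γ', hfin, by rw [he]; exact e⟩

end Monomials

/-! ### The Newton polyhedron of a monomial ideal. -/

section NewtonPolyhedron

variable {V : Type*} [NormedAddCommGroup V] [NormedSpace ℝ V] {M : Submodule ℤ V}
  {k : Type*} [Field k] {σ : PointedCone ℝ V}
  {𝔞 : Ideal (AddMonoidAlgebra k (latticePoints M σ))}

theorem coe_mem_newt {a : latticePoints M σ} (h : mono k a ∈ 𝔞) : ((a : M) : V) ∈ newt 𝔞 :=
  subset_convexHull _ _ ⟨a, h, rfl⟩

theorem convex_newt : Convex ℝ (newt 𝔞) := convex_convexHull _ _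

theorem newt_subset : newt 𝔞 ⊆ σ := by
  refine convexHull_min ?_ σ.convex
  rintro _ ⟨a, -, rfl⟩
  exact a.2

theorem add_mem_newt (hσ : IsRationalPolyhedral M σ) {x y : V} (hx : x ∈ newt 𝔞) (hy : y ∈ σ) :
    x + y ∈ newt 𝔞 := by
  obtain ⟨T, hTM, rfl⟩ := hσ
  suffices ∀ y ∈ PointedCone.hull ℝ (T : Set V), ∀ x ∈ newt 𝔞, x + y ∈ newt 𝔞 from this y hy x hx
  clear hx hy x y
  intro y hy
  refine Submodule.span_induction (fun t ht x hx => ?_) (fun x hx => by simpa using hx)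
    (fun y z _ _ h1 h2 x hx => by rw [← add_assoc]; exact h2 _ (h1 x hx)) ?_ hy
  · refine convexHull_min ?_ (convex_newt.translate_preimage_left t) hx
    rintro _ ⟨a, ha, rfl⟩
    exact coe_mem_newt (mono_add_mem ha ⟨⟨t, hTM ht⟩, PointedCone.subset_hull ht⟩)
  · rintro ⟨c, hc⟩ y - h x hx
    change x + c • y ∈ newt 𝔞
    -- Only integral translates come from the ideal structure; real multiples follow by convexity
    -- between x and x + n • y with n > c.
    have hn : ∀ n : ℕ, x + n • y ∈ newt 𝔞 := by
      intro n
      induction n with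
      | zero => simpa using hx
      | succ n ih => rw [succ_nsmul, ← add_assoc]; exact h _ ih
    obtain ⟨n, hcn⟩ := exists_nat_gt c
    have hn0 : (0 : ℝ) < n := hc.trans_lt hcn
    have := convex_newt hx (hn n) (a := 1 - c / n) (b := c / n)
      (sub_nonneg.2 ((div_le_one hn0).2 hcn.le)) (by positivity) (by ring)
    rw [← Nat.cast_smul_eq_nsmul ℝ, smul_add, smul_smul, div_mul_cancel₀ _ hn0.ne', ← add_assoc,
      ← add_smul, sub_add_cancel, one_smul] at this
    exact this

theorem IsRationalPolyhedral.fg (hσ : IsRationalPolyhedral M σ) : σ.FG := by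
  obtain ⟨T, -, rfl⟩ := hσ
  exact ⟨T, rfl⟩

theorem isHalfSpaceIntersection_newt [FiniteDimensional ℝ V] [DiscreteTopology M]
    (hσ : IsRationalPolyhedral M σ) (h𝔞 : IsMonomialIdeal 𝔞) :
    IsHalfSpaceIntersection (newt 𝔞) := by
  obtain ⟨Γ, hΓ, h⟩ := h𝔞.exists_finite hσ
  refine isHalfSpaceIntersection_of_recession convex_newt hσ.fg
    (fun x hx y hy => add_mem_newt hσ hx hy)
    (hΓ.image fun a : latticePoints M σ => ((a : M) : V)) ?_ (convexHull_mono ?_)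
  · rintro _ ⟨a, ha, rfl⟩
    exact coe_mem_newt (by rw [h]; exact Ideal.subset_span ⟨a, ha, rfl⟩)
  · rintro _ ⟨v, hv, rfl⟩
    rw [h] at hv
    obtain ⟨a, ha, s, rfl⟩ := mono_mem_span_mono_iff.1 hv
    exact ⟨_, ⟨a, ha, rfl⟩, ((s : M) : V), s.2, rfl⟩

/-- A half-space containing the Newton polyhedron bounds the exponents of powers of `𝔞`. -/
theorem nonneg_of_mem_pow (h𝔞 : IsMonomialIdeal 𝔞) {l : V →L[ℝ] ℝ} {c : ℝ}
    (hl : ∀ x ∈ newt 𝔞, 0 ≤ l x + c) (n : ℕ) {f : AddMonoidAlgebra k (latticePoints M σ)}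
    (hf : f ∈ 𝔞 ^ (n + 1)) {v : latticePoints M σ} (hv : v ∈ f.coeff.support) :
    0 ≤ l ((v : M) : V) + ((n : ℝ) + 1) * c := by
  classical
  -- The exponent starts at 1: for 𝔞 = 0 the hypothesis `hl` is vacuous, while 𝔞 ^ 0 is the whole
  -- ring.
  induction n generalizing f v with
  | zero =>
    rw [zero_add, pow_one] at hf
    simpa using hl _ (coe_mem_newt (h𝔞.mono_mem hf hv))
  | succ n ih =>
    rw [pow_succ] at hf
    refine Submodule.mul_induction_on (C := fun f => ∀ v : latticePoints M σ, v ∈ f.coeff.support →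
      0 ≤ l ((v : M) : V) + (((n + 1 : ℕ) : ℝ) + 1) * c) hf ?_ ?_ v hv
    · intro f hf g hg v hv
      obtain ⟨a, ha, b, hb, rfl⟩ := exists_add_of_mem_support_mul hv
      have h1 := ih hf ha
      have h2 := hl _ (coe_mem_newt (h𝔞.mono_mem hg hb))
      push_cast
      rw [map_add]
      linarith
    · intro f g hf hg v hv
      rw [AddMonoidAlgebra.coeff_add] at hv
      rcases Finset.mem_union.1 (Finsupp.support_add hv) with h | h
      · exact hf v h
      · exact hg v h

end NewtonPolyhedron

/-! ### Integral closures of powers of a monomial ideal. -/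

section IntegralClosureMonomial

theorem IsIntegralOverIdeal.exists_pow_mem {R : Type*} [CommRing R] {J : Ideal R} {x : R}
    (hx : IsIntegralOverIdeal J x) : ∃ n : ℕ, ∀ m, x ^ (m + n) ∈ J ^ m := by
  obtain ⟨n, a, ha, h⟩ := hx
  refine ⟨n, fun m => ?_⟩
  suffices ∀ m, x ^ m ∈ J ^ (m + 1 - n) from
    Ideal.pow_le_pow_right (by omega) (this (m + n))
  clear m
  intro m
  induction m using Nat.strong_induction_on with
  | _ m ih =>
    rcases lt_or_ge m n with hm | hm
    · rw [show m + 1 - n = 0 by omega, pow_zero, Ideal.one_eq_top]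
      trivial
    · have e : x ^ m = -∑ i ∈ Finset.range n, a i * x ^ (i + (m - n)) := by
        rw [← sub_eq_zero, sub_neg_eq_add]
        calc _ = (x ^ n + ∑ i ∈ Finset.range n, a i * x ^ i) * x ^ (m - n) := by
              rw [add_mul, ← pow_add, Nat.add_sub_cancel' hm, Finset.sum_mul]
              simp only [pow_add, mul_assoc]
          _ = 0 := by rw [h, zero_mul]
      rw [e]
      refine neg_mem (sum_mem fun i hi => ?_)
      have hi' := Finset.mem_range.1 hi
      have := Ideal.mul_mem_mul (ha i hi') (ih (i + (m - n)) (by omega))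
      rw [← pow_add] at this
      exact Ideal.pow_le_pow_right (by omega) this

variable {V : Type*} [NormedAddCommGroup V] [NormedSpace ℝ V] {M : Submodule ℤ V}
  {k : Type*} [Field k] {σ : PointedCone ℝ V}
  {𝔞 : Ideal (AddMonoidAlgebra k (latticePoints M σ))}

/-- Frobenius is additive and M is torsion-free, so no terms cancel or merge. This allows support
bounds for f without first proving that the integral closure is monomial. -/
theorem nsmul_mem_support_pow_char (p : ℕ) [Fact p.Prime] [CharP k p] (s : ℕ)
    {f : AddMonoidAlgebra k (latticePoints M σ)} {v : latticePoints M σ}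
    (hv : v ∈ f.coeff.support) : p ^ s • v ∈ (f ^ p ^ s).coeff.support := by
  have : CharP (AddMonoidAlgebra k (latticePoints M σ)) p :=
    charP_of_injective_algebraMap (algebraMap k _).injective p
  have hinj : Function.Injective fun v : latticePoints M σ => p ^ s • v := by
    intro a b hab
    apply Subtype.ext
    refine nsmul_right_injective (M := M) (pow_ne_zero s (Nat.Prime.ne_zero (Fact.out : p.Prime))) ?_
    simpa using congrArg (Subtype.val) hab
  have e : f ^ p ^ s = ∑ a ∈ f.coeff.support,
      AddMonoidAlgebra.single (p ^ s • a) (f.coeff a ^ p ^ s) := by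
    conv_lhs => rw [← AddMonoidAlgebra.sum_coeff_single f, Finsupp.sum, sum_pow_char_pow p]
    simp only [AddMonoidAlgebra.single_pow]
  rw [Finsupp.mem_support_iff] at hv ⊢
  rw [e, AddMonoidAlgebra.coeff_sum, Finsupp.finsetSum_apply, Finset.sum_eq_single v]
  · simpa using fun h => absurd h hv
  · intro b _ hb
    rw [AddMonoidAlgebra.coeff_single, Finsupp.single_eq_of_ne]
    exact fun h => hb (hinj h).symm
  · intro h
    exact absurd (Finsupp.mem_support_iff.2 hv) h

theorem mem_idealIntegralClosure_pow_iff [FiniteDimensional ℝ V] [DiscreteTopology M]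
    (p : ℕ) [Fact p.Prime] [CharP k p]
    (hσ : IsRationalPolyhedral M σ) (h𝔞 : IsMonomialIdeal 𝔞) {N : ℕ} (hN : 0 < N)
    {f : AddMonoidAlgebra k (latticePoints M σ)} :
    f ∈ idealIntegralClosure (𝔞 ^ N) ↔
      ∀ v ∈ f.coeff.support, ((v : M) : V) ∈ (N : ℝ) • newt 𝔞 := by
  have hN' : (0 : ℝ) < N := by exact_mod_cast hN
  constructor
  · intro hf v hv
    obtain ⟨L, hL⟩ := isHalfSpaceIntersection_newt hσ h𝔞
    obtain ⟨n, hn⟩ := IsIntegralOverIdeal.exists_pow_mem hf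
    rw [Set.mem_smul_set_iff_inv_smul_mem₀ hN'.ne', hL]
    intro z hz
    -- f ^ p ^ s lies in 𝔞 ^ (N (p ^ s - n)), whose exponents satisfy the scaled inequality. The
    -- error n * N * z.2 does not depend on s and disappears in the limit.
    have key : ∀ s, n < p ^ s → 0 ≤ p ^ s * (z.1 ((v : M) : V) + N * z.2) - n * N * z.2 := by
      intro s hs
      have h1 := hn (p ^ s - n)
      rw [Nat.sub_add_cancel hs.le, ← pow_mul] at h1
      have hK : 0 < N * (p ^ s - n) := Nat.mul_pos hN (Nat.sub_pos_of_lt hs)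
      obtain ⟨K, hK'⟩ := Nat.exists_eq_succ_of_ne_zero hK.ne'
      rw [hK'] at h1
      have h2 := nonneg_of_mem_pow h𝔞 (fun x hx => (hL x).1 hx z hz) K h1
        (nsmul_mem_support_pow_char p s hv)
      have hK2 : (K : ℝ) + 1 = N * (p ^ s - n) := by
        have := congrArg (Nat.cast (R := ℝ)) hK'
        rw [Nat.cast_mul, Nat.cast_sub hs.le] at this
        push_cast at this
        exact this.symm
      rw [hK2] at h2
      have h3 : (((p ^ s • v : latticePoints M σ) : M) : V) = (p ^ s : ℕ) • ((v : M) : V) := by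
        push_cast; rfl
      rw [h3, map_nsmul, nsmul_eq_mul] at h2
      push_cast at h2
      linarith
    have hfin : 0 ≤ z.1 ((v : M) : V) + N * z.2 := by
      by_contra! hneg
      have hp : (1 : ℝ) < p := by exact_mod_cast (Fact.out : p.Prime).one_lt
      obtain ⟨s, hs⟩ := pow_unbounded_of_one_lt
        (max (n : ℝ) (-(n * N * z.2) / -(z.1 ((v : M) : V) + N * z.2))) hp
      have h1 := key s (by exact_mod_cast (le_max_left _ _).trans_lt hs)
      have h2 := (le_max_right _ _).trans_lt hs
      rw [div_lt_iff₀ (neg_pos.2 hneg)] at h2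
      linarith
    rw [map_smul, smul_eq_mul]
    have := mul_nonneg (inv_pos.2 hN').le hfin
    rwa [mul_add, inv_mul_cancel_left₀ hN'.ne'] at this
  · intro h
    refine mem_of_forall_mono_mem fun v hv => ?_
    obtain ⟨x, hx, e⟩ := h v hv
    obtain ⟨ι, s, w, z, hw0, hw1, hz, rfl⟩ := (convexHull_eq (R := ℝ) _).subset hx
    choose! a ha haz using hz
    rw [Finset.centerMass_eq_of_sum_1 _ _ hw1] at e
    have e' : ((v : M) : V) = ∑ i ∈ s, ((N : ℝ) * w i) • (((a i : latticePoints M σ) : M) : V) := by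
      rw [← e]
      simp only [Finset.smul_sum, smul_smul]
      exact Finset.sum_congr rfl fun i hi => by rw [haz i hi]
    -- Clearing denominators puts the n-th power of x^v in 𝔞 ^ (N n), so x^v is a root of the monic
    -- polynomial X^n - (x^v)^n.
    obtain ⟨n, c, hn, hc, hsum⟩ := exists_nsmul_eq_sum_nsmul (M := M) s
      (fun i => (((a i : latticePoints M σ) : M) : V)) (fun i _ => (a i : M).2)
      (fun i => (N : ℝ) * w i) (fun i hi => mul_nonneg hN'.le (hw0 i hi)) N
      (by rw [← Finset.mul_sum, hw1, mul_one]) (by rw [← e']; exact (v : M).2)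
    rw [← e'] at hsum
    have hv' : n • v = ∑ i ∈ s, c i • a i := by
      apply Subtype.ext
      apply Subtype.ext
      push_cast
      exact hsum
    have hmem : mono k v ^ n ∈ (𝔞 ^ N) ^ n := by
      have : mono k v ^ n = ∏ i ∈ s, mono k (a i) ^ c i := by
        rw [mono_pow, hv']
        simp only [mono, AddMonoidAlgebra.single_pow, one_pow]
        rw [AddMonoidAlgebra.prod_single]
        simp
      rw [this, ← pow_mul, mul_comm, ← hc, ← Finset.prod_pow_eq_pow_sum]
      exact Ideal.prod_mem_prod fun i hi => Ideal.pow_mem_pow (ha i hi) _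
    refine ⟨n, fun i => if i = 0 then -(mono k v ^ n) else 0, fun i _ => ?_, ?_⟩
    · dsimp only
      split_ifs with h0
      · rw [h0]
        exact neg_mem hmem
      · exact zero_mem _
    · rw [Finset.sum_eq_single 0 (fun i _ hi => by simp [hi])
        fun h => absurd (Finset.mem_range.2 hn) h]
      simp

end IntegralClosureMonomial

/-! ### The polyhedron P, including t = 0, and the admissible exponents. -/

section ScaledNewtonPolyhedron

variable {V : Type*} [NormedAddCommGroup V] [NormedSpace ℝ V] {M : Submodule ℤ V}
  {k : Type*} [Field k] {σ : PointedCone ℝ V}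
  {𝔞 : Ideal (AddMonoidAlgebra k (latticePoints M σ))} {t : ℚ}

theorem smul_coe_cone {c : ℝ} (hc : 0 < c) : c • (σ : Set V) = σ := by
  ext x
  rw [Set.mem_smul_set_iff_inv_smul_mem₀ hc.ne']
  exact PointedCone.smul_mem_iff _ (inv_pos.2 hc)

theorem convex_scaledNewt : Convex ℝ (scaledNewt t 𝔞) := by
  unfold scaledNewt
  split_ifs
  · exact σ.convex
  · exact convex_newt.smul _

theorem scaledNewt_subset (ht : 0 ≤ t) : scaledNewt t 𝔞 ⊆ σ := by
  unfold scaledNewt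
  split_ifs with h
  · exact subset_rfl
  · have : (0 : ℝ) < t := by exact_mod_cast lt_of_le_of_ne ht (Ne.symm h)
    rw [← smul_coe_cone this]
    exact Set.smul_set_mono newt_subset

theorem add_mem_scaledNewt (hσ : IsRationalPolyhedral M σ) (ht : 0 ≤ t) {x y : V}
    (hx : x ∈ scaledNewt t 𝔞) (hy : y ∈ σ) : x + y ∈ scaledNewt t 𝔞 := by
  unfold scaledNewt at hx ⊢
  split_ifs at hx ⊢ with h
  · exact add_mem hx hy
  · have ht0 : (0 : ℝ) < t := by exact_mod_cast lt_of_le_of_ne ht (Ne.symm h)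
    rw [Set.mem_smul_set_iff_inv_smul_mem₀ ht0.ne'] at hx ⊢
    rw [smul_add]
    exact add_mem_newt hσ hx (PointedCone.smul_mem _ (inv_pos.2 ht0).le hy)

theorem isHalfSpaceIntersection_scaledNewt [FiniteDimensional ℝ V] [DiscreteTopology M]
    (hσ : IsRationalPolyhedral M σ) (h𝔞 : IsMonomialIdeal 𝔞) (ht : 0 ≤ t) :
    IsHalfSpaceIntersection (scaledNewt t 𝔞) := by
  unfold scaledNewt
  split_ifs with h
  · exact isHalfSpaceIntersection_cone hσ.fg
  · exact (isHalfSpaceIntersection_newt hσ h𝔞).smul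
      (by exact_mod_cast lt_of_le_of_ne ht (Ne.symm h))

theorem mem_idealIntegralClosure_pow_iff_scaledNewt [FiniteDimensional ℝ V] [DiscreteTopology M]
    (p : ℕ) [Fact p.Prime] [CharP k p] (hσ : IsRationalPolyhedral M σ) (h𝔞 : IsMonomialIdeal 𝔞)
    (ht : 0 ≤ t) {N : ℕ} {r : ℚ} (hr : 0 < r) (hN : (N : ℚ) = t * r)
    {f : AddMonoidAlgebra k (latticePoints M σ)} :
    f ∈ idealIntegralClosure (𝔞 ^ N) ↔
      ∀ v ∈ f.coeff.support, ((v : M) : V) ∈ (r : ℝ) • scaledNewt t 𝔞 := by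
  have hr' : (0 : ℝ) < r := by exact_mod_cast hr
  unfold scaledNewt
  split_ifs with h
  · rw [h, zero_mul, Nat.cast_eq_zero] at hN
    rw [hN, smul_coe_cone hr', pow_zero]
    refine iff_of_true ⟨1, fun _ => -f, fun _ _ => ?_, by simp⟩ fun v _ => v.2
    rw [one_pow, Ideal.one_eq_top]
    trivial
  · have ht0 : 0 < t := lt_of_le_of_ne ht (Ne.symm h)
    have hN0 : 0 < N := by
      have : (0 : ℚ) < N := by rw [hN]; positivity
      exact_mod_cast this
    have hN' : (N : ℝ) = r * t := by rw [mul_comm]; exact_mod_cast congrArg (Rat.cast (K := ℝ)) hN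
    rw [mem_idealIntegralClosure_pow_iff p hσ h𝔞 hN0, hN', mul_smul]

/-- By Euler's theorem the denominator of t divides p ^ (n e) - 1 whenever n is a multiple of its
totient. -/
theorem exists_admissible_exponent {p e : ℕ} (hp : p.Prime) (ht : 0 ≤ t) (htp : ¬ p ∣ t.den)
    (B : ℕ) : ∃ n N : ℕ, B ≤ n ∧ 0 < n ∧ (N : ℚ) = t * ((p : ℚ) ^ (n * e) - 1) := by
  have hcop : p.Coprime t.den := (Nat.Prime.coprime_iff_not_dvd hp).2 htp
  have hφ : 0 < t.den.totient := Nat.totient_pos.2 t.den_pos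
  let n := t.den.totient * (B + 1)
  have hmod : 1 ≡ p ^ (n * e) [MOD t.den] := by
    have := ((Nat.ModEq.pow_totient hcop).pow ((B + 1) * e)).symm
    rwa [one_pow, ← pow_mul, ← mul_assoc] at this
  have h1 : 1 ≤ p ^ (n * e) := Nat.one_le_pow _ _ hp.pos
  obtain ⟨m, hm⟩ := (Nat.modEq_iff_dvd' h1).1 hmod
  refine ⟨n, t.num.toNat * m, ?_, by positivity, ?_⟩
  · calc B ≤ 1 * (B + 1) := by omega
      _ ≤ n := Nat.mul_le_mul_right _ hφ
  · have hnum : ((t.num.toNat : ℕ) : ℚ) = t.num := by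
      have := Int.toNat_of_nonneg (Rat.num_nonneg.2 ht)
      exact_mod_cast congrArg (Int.cast (R := ℚ)) this
    have hm' : (p : ℚ) ^ (n * e) - 1 = t.den * m := by
      have := congrArg (Nat.cast (R := ℚ)) hm
      rw [Nat.cast_sub h1] at this
      push_cast at this
      exact this
    rw [hm', Nat.cast_mul, hnum, ← mul_assoc, Rat.mul_den_eq_num]

end ScaledNewtonPolyhedron

/-! ### The homotheties inverted by the iterates of φ. -/

section Homothety

variable {A : Type*} [AddCommGroup A]

/-- The homothety `m ↦ q ^ n m + (1 + q + ⋯ + q ^ (n - 1)) w`. -/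
def homothety (q : ℕ) (w : A) (n : ℕ) (m : A) : A :=
  q ^ n • m + (∑ i ∈ Finset.range n, q ^ i) • w

theorem homothety_succ (q : ℕ) (w : A) (n : ℕ) (m : A) :
    homothety q w n (q • m + w) = homothety q w (n + 1) m := by
  simp only [homothety, Finset.sum_range_succ, pow_succ, add_nsmul, smul_add, mul_nsmul']
  abel

theorem homothety_add (q : ℕ) (w : A) (n : ℕ) (m b : A) :
    homothety q w n (m + b) = homothety q w n m + q ^ n • b := by
  simp only [homothety, smul_add]
  abel

end Homothety

/-! ### Iterates of the toric map on coefficients and monomials. -/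

section ToricMap

variable {V : Type*} [NormedAddCommGroup V] [NormedSpace ℝ V] {M : Submodule ℤ V}
  {k : Type*} [Field k] {σ : PointedCone ℝ V}

theorem coeff_inclusion_coe (f : AddMonoidAlgebra k (latticePoints M σ)) (v : latticePoints M σ) :
    (inclusion k f).coeff v = f.coeff v :=
  Finsupp.mapDomain_apply Subtype.coe_injective _ _

theorem exists_of_coeff_inclusion_ne_zero {f : AddMonoidAlgebra k (latticePoints M σ)} {m : M}
    (h : (inclusion k f).coeff m ≠ 0) : ∃ v ∈ f.coeff.support, (v : M) = m := by
  classical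
  have := Finsupp.mapDomain_support (Finsupp.mem_support_iff.2 h)
  simpa using this

theorem inclusion_injective : Function.Injective (inclusion k (M := M) (σ := σ)) :=
  AddMonoidAlgebra.mapDomain_injective Subtype.coe_injective

theorem inclusion_single (v : latticePoints M σ) (c : k) :
    inclusion k (AddMonoidAlgebra.single v c) = AddMonoidAlgebra.single (v : M) c :=
  AddMonoidAlgebra.mapDomain_single

theorem homothety_injective {q : ℕ} (hq : q ≠ 0) (w : M) (n : ℕ) :
    Function.Injective (homothety q w n) := fun _ _ h =>
  nsmul_right_injective (pow_ne_zero n hq) (add_right_cancel h)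

/-- The point w/(1-q) is the fixed point of m ↦ q m + w; this is where the translation vector u
comes from. -/
theorem coe_homothety_sub {q : ℕ} (hq : 1 < q) (w : M) (n : ℕ) (m : M) :
    ((homothety q w n m : M) : V) - (1 / (1 - (q : ℝ))) • (w : V) =
      (q : ℝ) ^ n • ((m : V) - (1 / (1 - (q : ℝ))) • (w : V)) := by
  have h1 : (1 : ℝ) - q ≠ 0 := by
    have : (1 : ℝ) < q := by exact_mod_cast hq
    linarith
  have h2 : ((∑ i ∈ Finset.range n, (q : ℝ) ^ i)) =
      1 / (1 - (q : ℝ)) - (q : ℝ) ^ n * (1 / (1 - (q : ℝ))) := by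
    have := geom_sum_mul (q : ℝ) n
    field_simp
    linarith
  have h3 : ((homothety q w n m : M) : V) =
      (q : ℝ) ^ n • (m : V) + (∑ i ∈ Finset.range n, (q : ℝ) ^ i) • (w : V) := by
    simp only [homothety, Submodule.coe_add, Submodule.coe_smul_of_tower,
      ← Nat.cast_smul_eq_nsmul ℝ]
    push_cast
    rfl
  rw [h3, h2, sub_smul, smul_sub, smul_smul]
  abel

variable {q : ℕ} {ψ : k →+ k}

theorem iterate_semilinear (hψ : ∀ c d, ψ (c ^ q * d) = c * ψ d) (n : ℕ) (c d : k) :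
    ψ^[n] (c ^ q ^ n * d) = c * ψ^[n] d := by
  induction n generalizing c with
  | zero => simp
  | succ n ih =>
    rw [Function.iterate_succ_apply', Function.iterate_succ_apply', pow_succ', pow_mul, ih, hψ]

variable {hq : q ≠ 0} {w : M} {φ : AddMonoid.End (AddMonoidAlgebra k (latticePoints M σ))}

theorem coeff_inclusion_iterate
    (hφ : ∀ f, inclusion k (φ f) = toricMap ψ q hq w (inclusion k f))
    (n : ℕ) (f : AddMonoidAlgebra k (latticePoints M σ)) (m : M) :
    (inclusion k ((φ ^ n) f)).coeff m = ψ^[n] ((inclusion k f).coeff (homothety q w n m)) := by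
  induction n generalizing m with
  | zero => simp [homothety]
  | succ n ih =>
    have h1 : (inclusion k ((φ ^ (n + 1)) f)).coeff m =
        ψ ((inclusion k ((φ ^ n) f)).coeff (q • m + w)) := by
      rw [pow_succ']
      change (inclusion k (φ ((φ ^ n) f))).coeff m = _
      rw [hφ]
      change ψ ((AddMonoidAlgebra.single (-w) 1 * inclusion k ((φ ^ n) f)).coeff (q • m)) = _
      rw [AddMonoidAlgebra.coeff_single_mul_apply, one_mul, neg_neg, add_comm]
    rw [h1, ih, homothety_succ, Function.iterate_succ_apply']

theorem exists_of_mem_support_iterate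
    (hφ : ∀ f, inclusion k (φ f) = toricMap ψ q hq w (inclusion k f))
    {n : ℕ} {f : AddMonoidAlgebra k (latticePoints M σ)} {v : latticePoints M σ}
    (hv : v ∈ ((φ ^ n) f).coeff.support) :
    ∃ a ∈ f.coeff.support, (a : M) = homothety q w n v := by
  refine exists_of_coeff_inclusion_ne_zero fun h => ?_
  rw [Finsupp.mem_support_iff, ← coeff_inclusion_coe, coeff_inclusion_iterate hφ, h] at hv
  exact hv (iterate_map_zero ψ n)

theorem iterate_single (hψ : ∀ c d, ψ (c ^ q * d) = c * ψ d) (hψ1 : ψ 1 = 1)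
    (hφ : ∀ f, inclusion k (φ f) = toricMap ψ q hq w (inclusion k f))
    {n : ℕ} {v a : latticePoints M σ} (ha : (a : M) = homothety q w n v) (c : k) :
    (φ ^ n) (AddMonoidAlgebra.single a (c ^ q ^ n)) = AddMonoidAlgebra.single v c := by
  apply inclusion_injective
  ext m
  rw [coeff_inclusion_iterate hφ, inclusion_single, inclusion_single, ha,
    AddMonoidAlgebra.coeff_single, AddMonoidAlgebra.coeff_single]
  by_cases h : (v : M) = m
  · rw [h, Finsupp.single_eq_same, Finsupp.single_eq_same]
    have := iterate_semilinear hψ n c 1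
    rwa [mul_one, Function.iterate_fixed hψ1, mul_one] at this
  · rw [Finsupp.single_eq_of_ne' h,
      Finsupp.single_eq_of_ne' fun h' => h (homothety_injective hq w n h')]
    exact iterate_map_zero ψ n

theorem iterate_single_mul (hψ : ∀ c d, ψ (c ^ q * d) = c * ψ d)
    (hφ : ∀ f, inclusion k (φ f) = toricMap ψ q hq w (inclusion k f))
    (n : ℕ) (b : latticePoints M σ) (c : k) (f : AddMonoidAlgebra k (latticePoints M σ)) :
    (φ ^ n) (AddMonoidAlgebra.single (q ^ n • b) (c ^ q ^ n) * f) =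
      AddMonoidAlgebra.single b c * (φ ^ n) f := by
  apply inclusion_injective
  ext m
  rw [coeff_inclusion_iterate hφ, map_mul, map_mul, inclusion_single, inclusion_single,
    AddMonoidAlgebra.coeff_single_mul_apply, AddMonoidAlgebra.coeff_single_mul_apply,
    iterate_semilinear hψ, coeff_inclusion_iterate hφ, add_comm (-(b : M)) m, homothety_add,
    smul_neg, add_comm (homothety q w n m)]
  rfl

end ToricMap

/-! ### Separation of lattice points modulo q^n M. -/

section Separation

variable {V : Type*} [NormedAddCommGroup V] [NormedSpace ℝ V] [FiniteDimensional ℝ V]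
  {M : Submodule ℤ V} [DiscreteTopology M]

/-- Otherwise the vectors d / q^n would be infinitely many distinct lattice points in a bounded set.
-/
theorem exists_forall_ne_pow_nsmul {q : ℕ} (hq : 1 < q) {d : M} (hd : d ≠ 0) :
    ∃ B, ∀ n, B ≤ n → ∀ x : M, d ≠ q ^ n • x := by
  suffices ∃ B, ∀ x : M, d ≠ q ^ B • x by
    obtain ⟨B, hB⟩ := this
    refine ⟨B, fun n hn x h => hB (q ^ (n - B) • x) ?_⟩
    rw [h, ← mul_nsmul', ← pow_add, Nat.add_sub_cancel' hn]
  by_contra! h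
  choose x hx using h
  have hx' : ∀ n, (d : V) = ((q : ℝ) ^ n) • (x n : V) := by
    intro n
    have := congrArg (Subtype.val) (hx n)
    rw [this, Submodule.coe_smul_of_tower, ← Nat.cast_smul_eq_nsmul ℝ, Nat.cast_pow]
  have hq' : (1 : ℝ) < q := by exact_mod_cast hq
  have hmem : ∀ n, x n ∈ {m : M | ‖(m : V)‖ ≤ ‖(d : V)‖} := by
    intro n
    change ‖(x n : V)‖ ≤ ‖(d : V)‖
    rw [hx' n, norm_smul, Real.norm_of_nonneg (by positivity)]
    exact le_mul_of_one_le_left (norm_nonneg _) (one_le_pow₀ hq'.le)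
  obtain ⟨n, n', hlt, he⟩ := (finite_norm_le (M := M) _).exists_lt_map_eq_of_forall_mem hmem
  have h1 : ((q : ℝ) ^ n) • (x n : V) = ((q : ℝ) ^ n') • (x n : V) := by
    rw [← hx' n, hx' n', he]
  have h0 : (x n : V) ≠ 0 := by
    intro h0
    apply hd
    apply Subtype.ext
    rw [hx' n, h0, smul_zero, Submodule.coe_zero]
  have h2 := smul_left_injective ℝ h0 h1
  exact hlt.ne (pow_right_injective₀ (by positivity) hq'.ne' h2)

theorem exists_separating_exponent {q : ℕ} (hq : 1 < q) {D : Set M} (hD : D.Finite) :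
    ∃ B, ∀ n, B ≤ n → ∀ d ∈ D, ∀ d' ∈ D, ∀ x : M, d - d' = q ^ n • x → d = d' := by
  classical
  have h : ∀ d : M, ∃ B, d ≠ 0 → ∀ n, B ≤ n → ∀ x : M, d ≠ q ^ n • x := by
    intro d
    by_cases hd : d = 0
    · exact ⟨0, fun h => absurd hd h⟩
    · obtain ⟨B, hB⟩ := exists_forall_ne_pow_nsmul hq hd
      exact ⟨B, fun _ => hB⟩
  choose B hB using h
  refine ⟨(hD.sub hD).toFinset.sup B, fun n hn d hd d' hd' x hx => ?_⟩
  by_contra hne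
  refine hB (d - d') (sub_ne_zero.2 hne) n (le_trans ?_ hn) x hx
  exact Finset.le_sup (f := B) ((hD.sub hD).mem_toFinset.2 (Set.sub_mem_sub hd hd'))

end Separation

/-! ### Elements of a fixed ideal as sums of high iterates. -/

section Tail

variable {V : Type*} [NormedAddCommGroup V] [NormedSpace ℝ V] {M : Submodule ℤ V}
  {k : Type*} [Field k] {σ : PointedCone ℝ V}

/-- The additive subgroup generated by the `φ ^ n (c x ^ b h)` with `h ∈ H`, `b ∈ (q ^ n - 1) P`,
for `n ∈ 𝒩` with `n ≥ B`. -/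
noncomputable def tailSubgroup (φ : AddMonoid.End (AddMonoidAlgebra k (latticePoints M σ))) (q : ℕ)
    (P : Set V) (𝒩 : Set ℕ) (H : Set (AddMonoidAlgebra k (latticePoints M σ))) (B : ℕ) :
    AddSubgroup (AddMonoidAlgebra k (latticePoints M σ)) :=
  AddSubgroup.closure {g | ∃ n ∈ 𝒩, B ≤ n ∧ ∃ (b : latticePoints M σ) (c : k),
    ((b : M) : V) ∈ ((q : ℝ) ^ n - 1) • P ∧ ∃ h ∈ H, g = (φ ^ n) (AddMonoidAlgebra.single b c * h)}

variable {q : ℕ} {ψ : k →+ k} {hq : q ≠ 0} {w : M}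
  {φ : AddMonoid.End (AddMonoidAlgebra k (latticePoints M σ))}
  {P : Set V} {𝒩 : Set ℕ} {J : ℕ → Ideal (AddMonoidAlgebra k (latticePoints M σ))}
  {I : Ideal (AddMonoidAlgebra k (latticePoints M σ))}
  {H : Set (AddMonoidAlgebra k (latticePoints M σ))}

/-- Since q^m (q^n - 1) + (q^m - 1) = q^(n+m) - 1, convexity of P makes the multipliers compatible
with composition of iterates. -/
theorem pow_smul_add_mem (hq1 : 1 ≤ q) (hP : Convex ℝ P) {n m : ℕ} {x y : V}
    (hx : x ∈ ((q : ℝ) ^ n - 1) • P) (hy : y ∈ ((q : ℝ) ^ m - 1) • P) :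
    q ^ m • x + y ∈ ((q : ℝ) ^ (n + m) - 1) • P := by
  have h1 : ∀ n, 0 ≤ (q : ℝ) ^ n - 1 := fun n =>
    sub_nonneg.2 (one_le_pow₀ (by exact_mod_cast hq1))
  have e : (q : ℝ) ^ (n + m) - 1 = (q : ℝ) ^ m * ((q : ℝ) ^ n - 1) + ((q : ℝ) ^ m - 1) := by
    rw [pow_add]; ring
  rw [e, hP.add_smul (mul_nonneg (by positivity) (h1 n)) (h1 m), mul_smul,
    ← Nat.cast_smul_eq_nsmul ℝ, Nat.cast_pow]
  exact Set.add_mem_add (Set.smul_mem_smul_set hx) hy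

theorem iterate_mul_mem_tailSubgroup
    (hJ : ∀ n ∈ 𝒩, ∀ f, f ∈ J n ↔ ∀ v ∈ f.coeff.support, ((v : M) : V) ∈ ((q : ℝ) ^ n - 1) • P)
    (hH : Ideal.span H = I) {n : ℕ} (hn : n ∈ 𝒩)
    {f : AddMonoidAlgebra k (latticePoints M σ)} (hf : f ∈ J n * I) :
    (φ ^ n) f ∈ tailSubgroup φ q P 𝒩 H 0 := by
  refine Submodule.mul_induction_on hf (fun j hj i hi => ?_) fun x y hx hy => by
    rw [map_add]; exact add_mem hx hy
  rw [← hH] at hi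
  refine Submodule.span_induction (p := fun i _ => ∀ j ∈ J n,
    (φ ^ n) (j * i) ∈ tailSubgroup φ q P 𝒩 H 0) ?_ ?_ ?_ ?_ hi j hj
  · intro h hh j hj
    rw [← AddMonoidAlgebra.sum_coeff_single j, Finsupp.sum, Finset.sum_mul, map_sum]
    refine sum_mem fun b hb => AddSubgroup.subset_closure ?_
    exact ⟨n, hn, n.zero_le, b, _, (hJ n hn j).1 hj b hb, h, hh, rfl⟩
  · intro j _
    rw [mul_zero, map_zero]
    exact zero_mem _
  · intro x y _ _ hx hy j hj
    rw [mul_add, map_add]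
    exact add_mem (hx j hj) (hy j hj)
  · intro r x _ hx j hj
    rw [smul_eq_mul, ← mul_assoc]
    exact hx _ (Ideal.mul_mem_right _ _ hj)

theorem mem_tailSubgroup_of_fixed (hψ : ∀ c d, ψ (c ^ q * d) = c * ψ d)
    (hφ : ∀ f, inclusion k (φ f) = toricMap ψ q hq w (inclusion k f))
    (hP : Convex ℝ P) (hpos : ∀ n ∈ 𝒩, 0 < n) (hadd : ∀ n ∈ 𝒩, ∀ m ∈ 𝒩, n + m ∈ 𝒩)
    (hJ : ∀ n ∈ 𝒩, ∀ f, f ∈ J n ↔ ∀ v ∈ f.coeff.support, ((v : M) : V) ∈ ((q : ℝ) ^ n - 1) • P)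
    (hI : Submodule.toAddSubgroup I ≤ ⨆ n ∈ 𝒩, (Submodule.toAddSubgroup (J n * I)).map (φ ^ n))
    (hH : Ideal.span H = I) (B : ℕ) : Submodule.toAddSubgroup I ≤ tailSubgroup φ q P 𝒩 H B := by
  have h0 : Submodule.toAddSubgroup I ≤ tailSubgroup φ q P 𝒩 H 0 := by
    refine hI.trans (iSup₂_le fun n hn => ?_)
    rintro _ ⟨f, hf, rfl⟩
    exact iterate_mul_mem_tailSubgroup hJ hH hn hf
  induction B with
  | zero => exact h0
  | succ B ih =>
    refine h0.trans ((AddSubgroup.closure_le _).2 ?_)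
    rintro _ ⟨n, hn, -, b, c, hb, h, hh, rfl⟩
    -- The generator h is itself in I, so it is a sum of iterates of order at least B; applying φ ^
    -- n with n > 0 raises the order.
    have hhI : h ∈ tailSubgroup φ q P 𝒩 H B := ih (hH ▸ Ideal.subset_span hh)
    refine AddSubgroup.closure_induction (p := fun g _ =>
      (φ ^ n) (AddMonoidAlgebra.single b c * g) ∈ tailSubgroup φ q P 𝒩 H (B + 1))
      ?_ ?_ ?_ ?_ hhI
    · rintro _ ⟨m, hm, hBm, b', c', hb', h', hh', rfl⟩
      rw [← iterate_single_mul hψ hφ, ← mul_assoc, AddMonoidAlgebra.single_mul_single]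
      refine AddSubgroup.subset_closure ⟨n + m, hadd n hn m hm, by have := hpos n hn; omega,
        q ^ m • b + b', c ^ q ^ m * c',
        pow_smul_add_mem (Nat.one_le_iff_ne_zero.2 hq) hP hb hb', h', hh', ?_⟩
      rw [pow_add]
      rfl
    · rw [mul_zero, map_zero]
      exact zero_mem _
    · intro x y _ _ hx hy
      rw [mul_add, map_add]
      exact add_mem hx hy
    · intro x _ hx
      rw [mul_neg, map_neg]
      exact neg_mem hx

theorem mono_mem_of_support_subsingleton {f : AddMonoidAlgebra k (latticePoints M σ)} (hf : f ∈ I)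
    (h : ∀ a ∈ f.coeff.support, ∀ b ∈ f.coeff.support, a = b) {v : latticePoints M σ}
    (hv : v ∈ f.coeff.support) : mono k v ∈ I := by
  have hc := Finsupp.mem_support_iff.1 hv
  have e : f = AddMonoidAlgebra.single v (f.coeff v) := by
    ext a
    rw [AddMonoidAlgebra.coeff_single]
    by_cases ha : v = a
    · rw [← ha, Finsupp.single_eq_same]
    · rw [Finsupp.single_eq_of_ne' ha]
      exact Finsupp.notMem_support_iff.1 fun ha' => ha (h v hv a ha')
  have e2 : mono k v = AddMonoidAlgebra.single 0 (f.coeff v)⁻¹ *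
      AddMonoidAlgebra.single v (f.coeff v) := by
    rw [AddMonoidAlgebra.single_mul_single, zero_add, inv_mul_cancel₀ hc, mono]
  rw [e2, ← e]
  exact I.mul_mem_left _ hf

theorem mono_mem_of_mem_tailSubgroup [FiniteDimensional ℝ V] [DiscreteTopology M] (hq1 : 1 < q)
    (hφ : ∀ f, inclusion k (φ f) = toricMap ψ q hq w (inclusion k f))
    (hJ : ∀ n ∈ 𝒩, ∀ f, f ∈ J n ↔ ∀ v ∈ f.coeff.support, ((v : M) : V) ∈ ((q : ℝ) ^ n - 1) • P)
    (hI : ∀ n ∈ 𝒩, ∀ f ∈ J n * I, (φ ^ n) f ∈ I) (hH : H ⊆ I) (hfin : H.Finite) :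
    ∃ B, ∀ f ∈ tailSubgroup φ q P 𝒩 H B, ∀ v ∈ f.coeff.support, mono k v ∈ I := by
  classical
  let D : Set M := ⋃ h ∈ H, (fun v : latticePoints M σ => (v : M)) '' (h.coeff.support : Set _)
  have hD : D.Finite := hfin.biUnion fun h _ => (h.coeff.support.finite_toSet).image _
  obtain ⟨B, hB⟩ := exists_separating_exponent hq1 hD
  refine ⟨B, fun f hf => ?_⟩
  refine AddSubgroup.closure_induction
    (p := fun f _ => ∀ v : latticePoints M σ, v ∈ f.coeff.support → mono k v ∈ I) ?_ ?_ ?_ ?_ hf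
  · rintro _ ⟨n, hn, hBn, b, c, hb, h, hh, rfl⟩ v hv
    have hmem : (φ ^ n) (AddMonoidAlgebra.single b c * h) ∈ I := by
      refine hI n hn _ (Ideal.mul_mem_mul ((hJ n hn _).2 fun a ha => ?_) (hH hh))
      obtain rfl := Finset.mem_singleton.1 (Finsupp.support_single_subset ha)
      exact hb
    refine mono_mem_of_support_subsingleton hmem (fun a ha a' ha' => ?_) hv
    have key : ∀ a ∈ ((φ ^ n) (AddMonoidAlgebra.single b c * h)).coeff.support,
        ∃ d ∈ D, (b : M) + d = homothety q w n a := by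
      intro a ha
      obtain ⟨x, hx, hxa⟩ := exists_of_mem_support_iterate hφ ha
      obtain ⟨y, hy, d, hd, rfl⟩ := exists_add_of_mem_support_mul hx
      obtain rfl := Finset.mem_singleton.1 (Finsupp.support_single_subset hy)
      exact ⟨d, Set.mem_biUnion hh ⟨d, hd, rfl⟩, hxa⟩
    obtain ⟨d, hd, hda⟩ := key a ha
    obtain ⟨d', hd', hda'⟩ := key a' ha'
    -- Two exponents surviving in one term come from exponents of h that are congruent modulo q^n M,
    -- hence equal.
    have hdd : d - d' = q ^ n • ((a : M) - a') := by
      have h1 : d - d' = homothety q w n a - homothety q w n a' := by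
        rw [← hda, ← hda', add_sub_add_left_eq_sub]
      rw [h1, homothety, homothety, smul_sub, add_sub_add_right_eq_sub]
    have := hB n hBn d hd d' hd' _ hdd
    rw [← this, hda] at hda'
    exact Subtype.ext (homothety_injective hq w n hda')
  · intro v hv
    simp at hv
  · intro x y _ _ hx hy v hv
    rw [AddMonoidAlgebra.coeff_add] at hv
    rcases Finset.mem_union.1 (Finsupp.support_add hv) with h | h
    · exact hx v h
    · exact hy v h
  · intro x _ hx v hv
    rw [AddMonoidAlgebra.coeff_neg, Finsupp.support_neg] at hv
    exact hx v hv

theorem exists_of_mem_tailSubgroup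
    (hφ : ∀ f, inclusion k (φ f) = toricMap ψ q hq w (inclusion k f)) {B : ℕ}
    {f : AddMonoidAlgebra k (latticePoints M σ)} (hf : f ∈ tailSubgroup φ q P 𝒩 H B)
    {v : latticePoints M σ} (hv : v ∈ f.coeff.support) :
    ∃ n ≥ B, ∃ b ∈ ((q : ℝ) ^ n - 1) • P, ∃ h ∈ H, ∃ d ∈ h.coeff.support,
      ((homothety q w n v : M) : V) = b + ((d : M) : V) := by
  classical
  refine AddSubgroup.closure_induction
    (p := fun f _ => ∀ v : latticePoints M σ, v ∈ f.coeff.support →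
      ∃ n ≥ B, ∃ b ∈ ((q : ℝ) ^ n - 1) • P, ∃ h ∈ H, ∃ d ∈ h.coeff.support,
        ((homothety q w n v : M) : V) = b + ((d : M) : V)) ?_ ?_ ?_ ?_ hf v hv
  · rintro _ ⟨n, -, hBn, b, c, hb, h, hh, rfl⟩ v hv
    obtain ⟨x, hx, hxa⟩ := exists_of_mem_support_iterate hφ hv
    obtain ⟨y, hy, d, hd, rfl⟩ := exists_add_of_mem_support_mul hx
    obtain rfl := Finset.mem_singleton.1 (Finsupp.support_single_subset hy)
    exact ⟨n, hBn, _, hb, h, hh, d, hd, by rw [← hxa]; rfl⟩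
  · intro v hv
    simp at hv
  · intro x y _ _ hx hy v hv
    rw [AddMonoidAlgebra.coeff_add] at hv
    rcases Finset.mem_union.1 (Finsupp.support_add hv) with h | h
    · exact hx v h
    · exact hy v h
  · intro x _ hx v hv
    rw [AddMonoidAlgebra.coeff_neg, Finsupp.support_neg] at hv
    exact hx v hv

theorem sub_mem_of_mem_tailSubgroup (hq1 : 1 < q)
    (hφ : ∀ f, inclusion k (φ f) = toricMap ψ q hq w (inclusion k f))
    (hP : IsHalfSpaceIntersection P) (hfin : H.Finite)
    {f : AddMonoidAlgebra k (latticePoints M σ)} (hf : ∀ B, f ∈ tailSubgroup φ q P 𝒩 H B)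
    {v : latticePoints M σ} (hv : v ∈ f.coeff.support) :
    ((v : M) : V) - (1 / (1 - (q : ℝ))) • (w : V) ∈ P := by
  obtain ⟨L, hL⟩ := hP
  refine (hL _).2 fun z hz => ?_
  have hq' : (1 : ℝ) < q := by exact_mod_cast hq1
  let u : V := (1 / (1 - (q : ℝ))) • (w : V)
  let D : Set ℝ := ⋃ h ∈ H, (fun d : latticePoints M σ => z.1 (((d : M) : V) - u)) ''
    (h.coeff.support : Set _)
  have hD : D.Finite := hfin.biUnion fun h _ => (h.coeff.support.finite_toSet).image _
  obtain ⟨C, hC⟩ := hD.bddBelow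
  by_contra! hneg
  -- If z were negative at v - u, then q^n times that value would fall below C + z.2 for large n,
  -- whereas the expression for v in terms of b and d keeps it at least C + z.2.
  obtain ⟨B, hB⟩ := pow_unbounded_of_one_lt
    ((C + z.2) / (z.1 (((v : M) : V) - u) + z.2)) hq'
  obtain ⟨n, hn, _, ⟨b, hb, rfl⟩, h, hh, d, hd, e⟩ := exists_of_mem_tailSubgroup hφ (hf B) hv
  have h1 := congrArg (fun x => z.1 (x - u)) e
  simp only at h1
  rw [coe_homothety_sub hq1, add_sub_assoc, map_add, map_smul, map_smul, smul_eq_mul,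
    smul_eq_mul] at h1
  have h2 := (hL b).1 hb z hz
  have h3 : C ≤ z.1 (((d : M) : V) - u) := hC (Set.mem_biUnion hh ⟨d, hd, rfl⟩)
  have h4 : 1 ≤ (q : ℝ) ^ n := one_le_pow₀ hq'.le
  have h5 := mul_nonneg (sub_nonneg.2 h4) h2
  have h6 : (q : ℝ) ^ B ≤ (q : ℝ) ^ n := pow_le_pow_right₀ hq'.le hn
  have h7 := hB.trans_le h6
  rw [div_lt_iff_of_neg hneg] at h7
  change (q : ℝ) ^ n * (z.1 (((v : M) : V) - u) + z.2) < _ at h7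
  change (q : ℝ) ^ n * z.1 (((v : M) : V) - u) = _ at h1
  linarith

end Tail

/-! ### Fixed ideals and sums of the ideals I_F. -/

section FixedIdeals

variable {V : Type*} [NormedAddCommGroup V] [NormedSpace ℝ V] {M : Submodule ℤ V}
  {k : Type*} [Field k] {σ : PointedCone ℝ V}
  {q : ℕ} {ψ : k →+ k} {hq : q ≠ 0} {w : M}
  {φ : AddMonoid.End (AddMonoidAlgebra k (latticePoints M σ))}
  {P : Set V} {𝒩 : Set ℕ} {J : ℕ → Ideal (AddMonoidAlgebra k (latticePoints M σ))}
  {I : Ideal (AddMonoidAlgebra k (latticePoints M σ))}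

theorem smul_subset_cone (hPσ : P ⊆ σ) {c : ℝ} (hc : 0 ≤ c) : c • P ⊆ σ := by
  rintro _ ⟨x, hx, rfl⟩
  exact PointedCone.smul_mem _ hc (hPσ hx)

theorem mono_mem_of_coe_mem {n : ℕ} {C : Set V}
    (hJ : ∀ f, f ∈ J n ↔ ∀ v ∈ f.coeff.support, ((v : M) : V) ∈ C)
    {b : latticePoints M σ} (hb : ((b : M) : V) ∈ C) : mono k b ∈ J n := by
  refine (hJ _).2 fun a ha => ?_
  obtain rfl := Finset.mem_singleton.1 (Finsupp.support_single_subset ha)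
  exact hb

theorem sub_mem_of_mem_intrinsicInterior {F : Set V} {u x : V}
    (hx : x ∈ intrinsicInterior ℝ (u +ᵥ F)) : x - u ∈ F := by
  obtain ⟨g, hg, rfl⟩ := intrinsicInterior_subset hx
  simpa using hg

theorem exists_add_eq_homothety (hq1 : 1 < q) (hPσ : P ⊆ σ) {n : ℕ} {v v' : latticePoints M σ}
    (h : (q : ℝ) ^ n • (((v' : M) : V) - (1 / (1 - (q : ℝ))) • (w : V)) -
      (((v : M) : V) - (1 / (1 - (q : ℝ))) • (w : V)) ∈ ((q : ℝ) ^ n - 1) • P) :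
    ∃ b : latticePoints M σ, ((b : M) : V) ∈ ((q : ℝ) ^ n - 1) • P ∧
      ((b + v : latticePoints M σ) : M) = homothety q w n v' := by
  rw [← coe_homothety_sub hq1, sub_sub_sub_cancel_right] at h
  have h1 : (0 : ℝ) ≤ (q : ℝ) ^ n - 1 :=
    sub_nonneg.2 (one_le_pow₀ (by exact_mod_cast hq1.le))
  exact ⟨⟨homothety q w n v' - v, smul_subset_cone hPσ h1 h⟩, h, sub_add_cancel _ _⟩

theorem faceIdeal_le_of_mono_mem (hq1 : 1 < q)
    (hψ : ∀ c d, ψ (c ^ q * d) = c * ψ d) (hψ1 : ψ 1 = 1)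
    (hφ : ∀ f, inclusion k (φ f) = toricMap ψ q hq w (inclusion k f))
    (hPσ : P ⊆ σ) (hpos : ∀ n ∈ 𝒩, 0 < n) (hunb : ∀ B, ∃ n ∈ 𝒩, B ≤ n)
    (hJ : ∀ n ∈ 𝒩, ∀ f, f ∈ J n ↔ ∀ v ∈ f.coeff.support, ((v : M) : V) ∈ ((q : ℝ) ^ n - 1) • P)
    (hI : ∀ n ∈ 𝒩, ∀ f ∈ J n * I, (φ ^ n) f ∈ I)
    {v : latticePoints M σ} (hv : mono k v ∈ I) {F : Set V}
    (hvF : ((v : M) : V) - (1 / (1 - (q : ℝ))) • (w : V) ∈ F) :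
    faceIdeal k σ P ((1 / (1 - (q : ℝ))) • (w : V)) F ≤ I := by
  refine Ideal.span_le.2 ?_
  rintro _ ⟨v', rfl, F', hF', hFF', hv'⟩
  have hq' : (1 : ℝ) < q := by exact_mod_cast hq1
  set u : V := (1 / (1 - (q : ℝ))) • (w : V) with hu
  -- The parameter 1 + 1/(q^n - 1) is the one for which (q^n - 1) g = q^n (v' - u) - (v - u), where
  -- u + g is the prolonged point.
  have hlim : Filter.Tendsto (fun n : ℕ => 1 + ((q : ℝ) ^ n - 1)⁻¹) Filter.atTop (nhds 1) := by
    have h1 : Filter.Tendsto (fun n : ℕ => (q : ℝ) ^ n - 1) Filter.atTop Filter.atTop :=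
      Filter.tendsto_atTop_add_const_right _ _ (tendsto_pow_atTop_atTop_of_one_lt hq')
    simpa using h1.inv_tendsto_atTop.const_add (1 : ℝ)
  obtain ⟨B, hB⟩ := Filter.eventually_atTop.1 (hlim.eventually
    (eventually_lineMap_mem_of_mem_intrinsicInterior hv' (x := ((v : M) : V))
      ⟨_, hFF' hvF, by simp⟩))
  obtain ⟨n, hn, hBn⟩ := hunb B
  obtain ⟨g, hg, hge⟩ := hB n hBn
  have hn1 : (q : ℝ) ^ n - 1 ≠ 0 := (sub_pos.2 (one_lt_pow₀ hq' (hpos n hn).ne')).ne'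
  have hgP : g ∈ P := hF'.2.subset hg
  obtain ⟨b, hb, e⟩ := exists_add_eq_homothety (w := w) hq1 hPσ (n := n) (v := v) (v' := v') (by
    refine ⟨g, hgP, ?_⟩
    have hge' : g = (1 + ((q : ℝ) ^ n - 1)⁻¹) • (((v' : M) : V) - ((v : M) : V)) +
        ((v : M) : V) - u := eq_sub_of_add_eq' hge
    change ((q : ℝ) ^ n - 1) • g = _
    rw [hge', ← hu]
    have e1 : ((q : ℝ) ^ n - 1) * (1 + ((q : ℝ) ^ n - 1)⁻¹) = (q : ℝ) ^ n := by
      rw [mul_add, mul_inv_cancel₀ hn1, mul_one, sub_add_cancel]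
    rw [add_sub_assoc, smul_add, smul_smul, e1]
    module)
  have h1 := hI n hn _ (Ideal.mul_mem_mul (mono_mem_of_coe_mem (hJ n hn) hb) hv)
  have h2 := iterate_single hψ hψ1 hφ e (1 : k)
  rw [one_pow] at h2
  rw [mono_mul_mono, mono, h2] at h1
  exact h1

theorem eq_iSup_faceIdeal_of_fixed [FiniteDimensional ℝ V] [DiscreteTopology M]
    (hσ : IsRationalPolyhedral M σ) (hq1 : 1 < q)
    (hψ : ∀ c d, ψ (c ^ q * d) = c * ψ d) (hψ1 : ψ 1 = 1)
    (hφ : ∀ f, inclusion k (φ f) = toricMap ψ q hq w (inclusion k f))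
    (hP : Convex ℝ P) (hPh : IsHalfSpaceIntersection P) (hPσ : P ⊆ σ)
    (hpos : ∀ n ∈ 𝒩, 0 < n) (hunb : ∀ B, ∃ n ∈ 𝒩, B ≤ n)
    (hadd : ∀ n ∈ 𝒩, ∀ m ∈ 𝒩, n + m ∈ 𝒩)
    (hJ : ∀ n ∈ 𝒩, ∀ f, f ∈ J n ↔ ∀ v ∈ f.coeff.support, ((v : M) : V) ∈ ((q : ℝ) ^ n - 1) • P)
    (hI : (⨆ n ∈ 𝒩, (Submodule.toAddSubgroup (J n * I)).map (φ ^ n)) =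
      Submodule.toAddSubgroup I) :
    I = ⨆ F ∈ {F ∈ faces P | faceIdeal k σ P ((1 / (1 - (q : ℝ))) • (w : V)) F ≤ I},
      faceIdeal k σ P ((1 / (1 - (q : ℝ))) • (w : V)) F := by
  have hnoeth := isNoetherianRing_latticePoints (k := k) hσ
  obtain ⟨H, hH⟩ := (IsNoetherian.noetherian I : I.FG)
  have hIle : ∀ n ∈ 𝒩, ∀ f ∈ J n * I, (φ ^ n) f ∈ I := fun n hn f hf =>
    hI.le (AddSubgroup.mem_iSup_of_mem n (AddSubgroup.mem_iSup_of_mem hn ⟨f, hf, rfl⟩))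
  have htail := mem_tailSubgroup_of_fixed hψ hφ hP hpos hadd hJ hI.ge hH
  obtain ⟨B, hB⟩ := mono_mem_of_mem_tailSubgroup hq1 hφ hJ hIle
    (H := H) (hH ▸ Ideal.subset_span) H.finite_toSet
  refine le_antisymm (fun f hf => mem_of_forall_mono_mem fun v hv => ?_)
    (iSup₂_le fun F hF => hF.2)
  have hvI := hB f (htail B hf) v hv
  have hvP := sub_mem_of_mem_tailSubgroup hq1 hφ hPh H.finite_toSet (fun B => htail B hf) hv
  obtain ⟨F, hF, hvF⟩ := exists_face_mem_intrinsicInterior hPh hvP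
  refine Ideal.mem_iSup_of_mem F (Ideal.mem_iSup_of_mem ⟨hF, ?_⟩
    (Ideal.subset_span ⟨v, rfl, F, hF, subset_rfl, hvF⟩))
  exact faceIdeal_le_of_mono_mem hq1 hψ hψ1 hφ hPσ hpos hunb hJ hIle hvI
    (sub_mem_of_mem_intrinsicInterior hvF)

theorem iSup_faceIdeal_eq_span (u : V) (𝒢 : Set (Set V)) :
    ⨆ F ∈ 𝒢, faceIdeal k σ P u F = Ideal.span (mono k '' {v : latticePoints M σ | ∃ F ∈ 𝒢,
      ∃ F' ∈ faces P, F ⊆ F' ∧ ((v : M) : V) ∈ intrinsicInterior ℝ (u +ᵥ F')}) := by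
  refine le_antisymm (iSup₂_le fun F hF => Ideal.span_mono ?_) (Ideal.span_le.2 ?_)
  · rintro _ ⟨v, rfl, h⟩
    exact ⟨v, ⟨F, hF, h⟩, rfl⟩
  · rintro _ ⟨v, ⟨F, hF, h⟩, rfl⟩
    exact Ideal.mem_iSup_of_mem F (Ideal.mem_iSup_of_mem hF (Ideal.subset_span ⟨v, rfl, h⟩))

theorem fixed_iSup_faceIdeal (hq1 : 1 < q)
    (hψ : ∀ c d, ψ (c ^ q * d) = c * ψ d) (hψ1 : ψ 1 = 1)
    (hφ : ∀ f, inclusion k (φ f) = toricMap ψ q hq w (inclusion k f))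
    (hP : Convex ℝ P) (hPh : IsHalfSpaceIntersection P) (hPσ : P ⊆ σ)
    (hPadd : ∀ x ∈ P, ∀ y ∈ σ, x + y ∈ P)
    (hpos : ∀ n ∈ 𝒩, 0 < n) (hne : 𝒩.Nonempty)
    (hJ : ∀ n ∈ 𝒩, ∀ f, f ∈ J n ↔ ∀ v ∈ f.coeff.support, ((v : M) : V) ∈ ((q : ℝ) ^ n - 1) • P)
    {𝒢 : Set (Set V)}
    (hI : I = ⨆ F ∈ 𝒢, faceIdeal k σ P ((1 / (1 - (q : ℝ))) • (w : V)) F) :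
    (⨆ n ∈ 𝒩, (Submodule.toAddSubgroup (J n * I)).map (φ ^ n)) = Submodule.toAddSubgroup I := by
  rw [iSup_faceIdeal_eq_span] at hI
  have hq' : (1 : ℝ) < q := by exact_mod_cast hq1
  set u : V := (1 / (1 - (q : ℝ))) • (w : V) with hu
  refine le_antisymm (iSup₂_le fun n hn => ?_) fun f hf => ?_
  · have hn1 : 0 < (q : ℝ) ^ n - 1 := sub_pos.2 (one_lt_pow₀ hq' (hpos n hn).ne')
    rintro _ ⟨f, hf, rfl⟩
    change (φ ^ n) f ∈ I
    refine Submodule.mul_induction_on hf (fun j hj i hi => ?_) fun x y hx hy => by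
      rw [map_add]; exact add_mem hx hy
    refine mem_of_forall_mono_mem fun v hv => ?_
    obtain ⟨x, hx, hxv⟩ := exists_of_mem_support_iterate hφ hv
    obtain ⟨b, hb, c, hc, rfl⟩ := exists_add_of_mem_support_mul hx
    rw [hI] at hi ⊢
    obtain ⟨a, ⟨F, hF, F', hF', hFF', ha⟩, s, rfl⟩ := mem_span_mono_iff.1 hi c hc
    obtain ⟨b', hb', hbe⟩ := (hJ n hn j).1 hj b hb
    -- The factor s by which the exponent c exceeds the generator a is absorbed into the point of P,
    -- as σ consists of recession directions of P.
    have hy : b' + ((q : ℝ) ^ n - 1)⁻¹ • ((s : M) : V) ∈ P :=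
      hPadd _ hb' _ (PointedCone.smul_mem _ (inv_nonneg.2 hn1.le) s.2)
    have hr : 0 < ((q : ℝ) ^ n)⁻¹ := by positivity
    have hs : 0 ≤ 1 - ((q : ℝ) ^ n)⁻¹ :=
      sub_nonneg.2 (inv_le_one_of_one_le₀ (one_le_pow₀ hq'.le))
    have haP : ((a : M) : V) - u ∈ P := hF'.2.subset (sub_mem_of_mem_intrinsicInterior ha)
    have e : ((v : M) : V) - u = ((q : ℝ) ^ n)⁻¹ • (((a : M) : V) - u) +
        (1 - ((q : ℝ) ^ n)⁻¹) • (b' + ((q : ℝ) ^ n - 1)⁻¹ • ((s : M) : V)) := by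
      have h1 := coe_homothety_sub hq1 w n (v : M)
      rw [← hxv, ← hu] at h1
      have h2 : (((b + (a + s) : latticePoints M σ) : M) : V) =
          ((q : ℝ) ^ n - 1) • b' + (((a : M) : V) + ((s : M) : V)) := by
        rw [show ((q : ℝ) ^ n - 1) • b' = ((b : M) : V) from hbe]
        rfl
      rw [h2] at h1
      have hqn : (q : ℝ) ^ n ≠ 0 := by positivity
      have h3 := congrArg (fun x => ((q : ℝ) ^ n)⁻¹ • x) h1
      simp only [inv_smul_smul₀ hqn] at h3
      rw [← h3]
      have h4 : 1 - ((q : ℝ) ^ n)⁻¹ = ((q : ℝ) ^ n)⁻¹ * ((q : ℝ) ^ n - 1) := by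
        rw [mul_sub, inv_mul_cancel₀ hqn, mul_one]
      rw [h4, mul_smul, smul_add ((q : ℝ) ^ n - 1), smul_inv_smul₀ hn1.ne', ← smul_add]
      congr 1
      abel
    have hvP : ((v : M) : V) - u ∈ P := by
      rw [e]
      exact hP haP hy hr.le hs (by ring)
    obtain ⟨F'', hF'', hv''⟩ := exists_face_mem_intrinsicInterior hPh hvP
    have hsub := subset_face_of_combo_mem hF''.2 hF'.2.subset hv'' ha hy hr hs (by ring) e
    exact Ideal.subset_span ⟨v, ⟨F, hF, F'', hF'', hFF'.trans hsub, hv''⟩, rfl⟩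
  -- A single admissible n suffices: with b = (q^n - 1)(v - u) the homothety sends v to b + v, and
  -- q^n-th powers of coefficients undo ψ.
  · obtain ⟨n, hn⟩ := hne
    refine AddSubgroup.mem_iSup_of_mem n (AddSubgroup.mem_iSup_of_mem hn ?_)
    change f ∈ I at hf
    rw [← AddMonoidAlgebra.sum_coeff_single f, Finsupp.sum]
    refine sum_mem fun v hv => ?_
    have hvI : mono k v ∈ I := by
      rw [hI] at hf ⊢
      exact mono_mem_span_mono_iff.2 (mem_span_mono_iff.1 hf v hv)
    have hvP : ((v : M) : V) - u ∈ P := by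
      rw [hI] at hvI
      obtain ⟨a, ⟨F, hF, F', hF', hFF', ha⟩, s, rfl⟩ := mono_mem_span_mono_iff.1 hvI
      have := hPadd _ (hF'.2.subset (sub_mem_of_mem_intrinsicInterior ha)) _ s.2
      rwa [sub_add_eq_add_sub] at this
    obtain ⟨b, hb, e⟩ := exists_add_eq_homothety (w := w) hq1 hPσ (n := n) (v := v) (v' := v)
      ⟨_, hvP, by beta_reduce; rw [sub_smul, one_smul]⟩
    refine ⟨AddMonoidAlgebra.single (b + v) (f.coeff v ^ q ^ n), ?_,
      iterate_single hψ hψ1 hφ e _⟩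
    have : AddMonoidAlgebra.single (b + v) (f.coeff v ^ q ^ n) =
        mono k b * AddMonoidAlgebra.single v (f.coeff v ^ q ^ n) := by
      rw [mono, AddMonoidAlgebra.single_mul_single, one_mul]
    rw [this]
    exact Ideal.mul_mem_mul (mono_mem_of_coe_mem (hJ n hn) hb) (single_mem hvI _)

/-- The exponent N is determined by n, so the supremum can be indexed by the admissible n alone,
with N written as a floor. -/
theorem isCartierFixed_iff {p e : ℕ} {t : ℚ}
    {𝔞 : Ideal (AddMonoidAlgebra k (latticePoints M σ))} :
    IsCartierFixed p e φ t 𝔞 I ↔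
      (⨆ n ∈ {n : ℕ | 0 < n ∧ ∃ N : ℕ, (N : ℚ) = t * ((p : ℚ) ^ (n * e) - 1)},
        (Submodule.toAddSubgroup (idealIntegralClosure
          (𝔞 ^ ⌊t * ((p : ℚ) ^ (n * e) - 1)⌋₊) * I)).map (φ ^ n)) = Submodule.toAddSubgroup I := by
  unfold IsCartierFixed
  congr! 1
  refine iSup_congr fun n => le_antisymm (iSup_le fun N => iSup₂_le fun hn hN => ?_)
    (iSup_le ?_)
  · refine le_trans ?_ (le_iSup _ ⟨hn, N, hN⟩)
    rw [← hN, Nat.floor_natCast]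
  · rintro ⟨hn, N, hN⟩
    refine le_trans ?_ (le_iSup_of_le N (le_iSup₂ hn hN))
    rw [← hN, Nat.floor_natCast]

end FixedIdeals

end ToricFixed

/-! ### The main theorem. -/

theorem mainTheorem1 {V : Type*} [NormedAddCommGroup V] [NormedSpace ℝ V] [FiniteDimensional ℝ V]
    (M : Submodule ℤ V) [DiscreteTopology M] [IsZLattice ℝ M]
    (σ : PointedCone ℝ V) (hσ : ToricFixed.IsRationalPolyhedral M σ)
    (p : ℕ) [Fact p.Prime] (k : Type*) [Field k] [CharP k p]
    (e : ℕ) (he : 0 < e)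
    (ψ : k →+ k) (hψ : ToricFixed.IsFrobeniusSplitting p e ψ)
    (w : M)
    (φ : AddMonoid.End (AddMonoidAlgebra k (ToricFixed.latticePoints M σ)))
    (hφ : ∀ f, ToricFixed.inclusion k (φ f) =
      ToricFixed.toricMap ψ (p ^ e) (pow_ne_zero e (Nat.Prime.ne_zero Fact.out)) w
        (ToricFixed.inclusion k f))
    (𝔞 : Ideal (AddMonoidAlgebra k (ToricFixed.latticePoints M σ)))
    (h𝔞 : ToricFixed.IsMonomialIdeal 𝔞)
    (t : ℚ) (ht : 0 ≤ t) (htp : ¬ p ∣ t.den)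
    (I : Ideal (AddMonoidAlgebra k (ToricFixed.latticePoints M σ))) :
    (ToricFixed.IsCartierFixed p e φ t 𝔞 I ↔
      ∃ 𝒢 ⊆ ToricFixed.faces (ToricFixed.scaledNewt t 𝔞),
        I = ⨆ F ∈ 𝒢, ToricFixed.faceIdeal k σ (ToricFixed.scaledNewt t 𝔞)
          ((1 / (1 - (p : ℝ) ^ e)) • (w : V)) F) ∧
    (I ≠ ⊥ →
      (ToricFixed.IsCartierFixed p e φ t 𝔞 I ↔
        ∃ 𝒢 ⊆ ToricFixed.faces (ToricFixed.scaledNewt t 𝔞), 𝒢.Nonempty ∧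
          I = ⨆ F ∈ 𝒢, ToricFixed.faceIdeal k σ (ToricFixed.scaledNewt t 𝔞)
            ((1 / (1 - (p : ℝ) ^ e)) • (w : V)) F)) := by
  open ToricFixed in
  have hp : p.Prime := Fact.out
  have hq1 : 1 < p ^ e := Nat.one_lt_pow he.ne' hp.one_lt
  have hp1 : (1 : ℚ) < p := by exact_mod_cast hp.one_lt
  have main : IsCartierFixed p e φ t 𝔞 I ↔
      ∃ 𝒢 ⊆ faces (scaledNewt t 𝔞), I = ⨆ F ∈ 𝒢, faceIdeal k σ (scaledNewt t 𝔞)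
        ((1 / (1 - (p : ℝ) ^ e)) • (w : V)) F := by
    let 𝒩 : Set ℕ := {n | 0 < n ∧ ∃ N : ℕ, (N : ℚ) = t * ((p : ℚ) ^ (n * e) - 1)}
    let J : ℕ → Ideal (AddMonoidAlgebra k (latticePoints M σ)) := fun n =>
      idealIntegralClosure (𝔞 ^ ⌊t * ((p : ℚ) ^ (n * e) - 1)⌋₊)
    have hunb : ∀ B, ∃ n ∈ 𝒩, B ≤ n := by
      intro B
      obtain ⟨n, N, hB, hn, hN⟩ := exists_admissible_exponent (e := e) hp ht htp B
      exact ⟨n, ⟨hn, N, hN⟩, hB⟩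
    -- Uses t(q^(n+m) - 1) = q^m · t(q^n - 1) + t(q^m - 1).
    have hadd : ∀ n ∈ 𝒩, ∀ m ∈ 𝒩, n + m ∈ 𝒩 := by
      rintro n ⟨hn, N, hN⟩ m ⟨-, N', hN'⟩
      refine ⟨by omega, p ^ (m * e) * N + N', ?_⟩
      push_cast
      rw [hN, hN', add_mul, pow_add]
      ring
    have hJ : ∀ n ∈ 𝒩, ∀ f, f ∈ J n ↔ ∀ v ∈ f.coeff.support,
        ((v : M) : V) ∈ (((p ^ e : ℕ) : ℝ) ^ n - 1) • scaledNewt t 𝔞 := by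
      rintro n ⟨hn, N, hN⟩ f
      have hr : 0 < (p : ℚ) ^ (n * e) - 1 :=
        sub_pos.2 (one_lt_pow₀ hp1 (Nat.mul_ne_zero hn.ne' he.ne'))
      have e1 : ((((p : ℚ) ^ (n * e) - 1 : ℚ)) : ℝ) = ((p ^ e : ℕ) : ℝ) ^ n - 1 := by
        push_cast
        rw [← pow_mul, mul_comm]
      simp only [J]
      rw [← hN, Nat.floor_natCast,
        mem_idealIntegralClosure_pow_iff_scaledNewt p hσ h𝔞 ht hr hN, e1]
    have hu : 1 - (p : ℝ) ^ e = 1 - ((p ^ e : ℕ) : ℝ) := by push_cast; rfl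
    rw [isCartierFixed_iff, hu]
    constructor
    · intro h
      exact ⟨_, fun _ hF => hF.1, eq_iSup_faceIdeal_of_fixed hσ hq1 hψ.semilinear hψ.map_one hφ
        convex_scaledNewt (isHalfSpaceIntersection_scaledNewt hσ h𝔞 ht) (scaledNewt_subset ht)
        (fun n hn => hn.1) hunb hadd hJ h⟩
    · rintro ⟨𝒢, -, h⟩
      obtain ⟨n, hn, -⟩ := hunb 0
      exact fixed_iSup_faceIdeal hq1 hψ.semilinear hψ.map_one hφ
        convex_scaledNewt (isHalfSpaceIntersection_scaledNewt hσ h𝔞 ht) (scaledNewt_subset ht)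
        (fun x hx y hy => add_mem_scaledNewt hσ ht hx hy)
        (fun n hn => hn.1) ⟨n, hn⟩ hJ h
  -- The empty family has sum zero, so it cannot represent a nonzero ideal.
  refine ⟨main, fun hI => main.trans ⟨?_, ?_⟩⟩
  · rintro ⟨𝒢, h𝒢, h⟩
    refine ⟨𝒢, h𝒢, Set.nonempty_iff_ne_empty.2 ?_, h⟩
    rintro rfl
    exact hI (by simpa using h)
  · rintro ⟨𝒢, h𝒢, -, h⟩
    exact ⟨𝒢, h𝒢, h⟩
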